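/- For $d,N\in\mathbb N$, data $\mathcal D=\{(\mathbf a_i,b_i)\}_{i=1}^N$ with $\mathbf a_i\in\mathbb R^d$, $b_i\in\mathbb R$, and an inlier threshold $\epsilon\ge 0$, let the consensus of $\mathbf x\in\mathbb R^d$ be $$\Psi_\epsilon(\mathbf x\mid\mathcal D)=\sum_{i=1}^N \mathbb I\left(|\mathbf a_i^T\mathbf x-b_i|\le\epsilon\right).$$ MAXCON is the problem: given $\mathcal D$ and $\epsilon$, find $\mathbf x\in\mathbb R^d$ maximising $\Psi_\epsilon(\mathbf x\mid\mathcal D)$. MAXCON-D is its decision version: given in addition an integer $\psi\ge 1$, decide whether some $\mathbf x\in\mathbb R^d$ has $\Psi_\epsilon(\mathbf x\mid\mathcal D)\ge\psi$. Algorithms are programs of a deterministic random access machine with integer words (constants, addition, truncated subtraction, comparison, indirect addressing) and real words (rational constants, $+,-,\times,/$, comparison), each operation costing one step; the size of an input is its number of words. A problem with parameter $k$ is in XP (slice-wise polynomial) if there are computable functions $f,g:\mathbb N\to\mathbb N$ and a single program that solves every instance of size $n$ and parameter $k$ in at most $f(k)\,n^{g(k)}$ steps. **Theorem.** MAXCON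 and MAXCON-D, parameterised by the dimension $d$, are in XP. More precisely, each of the two problems is solved by a single program, for all $d$ and $N$, in $O(N^{d+2}\,\mathrm{poly}(d))$ time: there is a polynomial $P$ with natural number coefficients such that the program halts with a correct answer after at most $P(d)\cdot\max(1,N)^{d+2}$ steps on every instance with $N$ measurements in dimension $d$. -/

import Mathlib

/-! ## A real random access machine with unit costs -/

namespace RealRAM

/-- A configuration of the machine. There are integer registers and real registers, addressed only
by constants written in the program (so that a program uses finitely many of them), and integer and
real arrays. The number of an array is again a constant of the program, but the cells of an array
are addressed by the content of an integer register. -/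
structure State where
  nreg : ℕ → ℕ
  rreg : ℕ → ℝ
  nmem : ℕ → ℕ → ℕ
  rmem : ℕ → ℕ → ℝ

/-- The elementary instructions. The integer part has only addition and truncated subtraction; the
real part has the four arithmetic operations and rational constants (no rounding, no conversion
from reals to integers). -/
inductive Instr where
  | natConst (i c : ℕ)
  | natAdd (i j k : ℕ)
  | natSub (i j k : ℕ)
  | natLoad (m i j : ℕ)
  | natStore (m i j : ℕ)
  | realConst (i : ℕ) (q : ℚ)
  | realAdd (i j k : ℕ)
  | realSub (i j k : ℕ)
  | realMul (i j k : ℕ)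
  | realDiv (i j k : ℕ)
  | realLoad (m i j : ℕ)
  | realStore (m i j : ℕ)

/-- The effect of one elementary instruction (a division by zero returns zero). -/
noncomputable def Instr.apply : Instr → State → State
  | .natConst i c, s => { s with nreg := Function.update s.nreg i c }
  | .natAdd i j k, s => { s with nreg := Function.update s.nreg i (s.nreg j + s.nreg k) }
  | .natSub i j k, s => { s with nreg := Function.update s.nreg i (s.nreg j - s.nreg k) }
  | .natLoad m i j, s => { s with nreg := Function.update s.nreg i (s.nmem m (s.nreg j)) }
  | .natStore m i j, s =>
      { s with nmem := Function.update s.nmem m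
                 (Function.update (s.nmem m) (s.nreg i) (s.nreg j)) }
  | .realConst i q, s => { s with rreg := Function.update s.rreg i (q : ℝ) }
  | .realAdd i j k, s => { s with rreg := Function.update s.rreg i (s.rreg j + s.rreg k) }
  | .realSub i j k, s => { s with rreg := Function.update s.rreg i (s.rreg j - s.rreg k) }
  | .realMul i j k, s => { s with rreg := Function.update s.rreg i (s.rreg j * s.rreg k) }
  | .realDiv i j k, s => { s with rreg := Function.update s.rreg i (s.rreg j / s.rreg k) }
  | .realLoad m i j, s => { s with rreg := Function.update s.rreg i (s.rmem m (s.nreg j)) }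
  | .realStore m i j, s =>
      { s with rmem := Function.update s.rmem m
                 (Function.update (s.rmem m) (s.nreg i) (s.rreg j)) }

/-- The tests on which a program may branch: a comparison of two integer registers, or of two real
registers. -/
inductive Test where
  | natLe (i j : ℕ)
  | realLe (i j : ℕ)

def Test.Holds : Test → State → Prop
  | .natLe i j, s => s.nreg i ≤ s.nreg j
  | .realLe i j, s => s.rreg i ≤ s.rreg j

/-- Programs. -/
inductive Program where
  | skip
  | op (e : Instr)
  | seq (p q : Program)
  | ite (t : Test) (p q : Program)
  | loop (t : Test) (p : Program)

/-- `Exec p s s' n`: started in the configuration `s`, the program `p` halts in the configuration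
`s'` after exactly `n` steps. Every elementary instruction and every evaluation of a test is one
step; `loop t p` repeats `p` as long as `t` holds. -/
inductive Exec : Program → State → State → ℕ → Prop where
  | skip (s : State) : Exec .skip s s 1
  | op (e : Instr) (s : State) : Exec (.op e) s (e.apply s) 1
  | seq {p q : Program} {s s' s'' : State} {m n : ℕ} :
      Exec p s s' m → Exec q s' s'' n → Exec (.seq p q) s s'' (m + n)
  | ite_true {t : Test} {p q : Program} {s s' : State} {n : ℕ} :
      t.Holds s → Exec p s s' n → Exec (.ite t p q) s s' (n + 1)
  | ite_false {t : Test} {p q : Program} {s s' : State} {n : ℕ} :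
      ¬ t.Holds s → Exec q s s' n → Exec (.ite t p q) s s' (n + 1)
  | loop_true {t : Test} {p : Program} {s s' s'' : State} {m n : ℕ} :
      t.Holds s → Exec p s s' m → Exec (.loop t p) s' s'' n → Exec (.loop t p) s s'' (m + n + 1)
  | loop_false {t : Test} {p : Program} {s : State} :
      ¬ t.Holds s → Exec (.loop t p) s s 1

/-- The machine is deterministic. -/
theorem Exec.unique {p : Program} {s s₁ s₂ : State} {n₁ n₂ : ℕ}
    (h₁ : Exec p s s₁ n₁) (h₂ : Exec p s s₂ n₂) : s₁ = s₂ ∧ n₁ = n₂ := by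
  induction h₁ generalizing s₂ n₂ with
  | skip s => cases h₂; exact ⟨rfl, rfl⟩
  | op e s => cases h₂; exact ⟨rfl, rfl⟩
  | seq _ _ ih ih' =>
    cases h₂ with
    | seq a b =>
      obtain ⟨rfl, rfl⟩ := ih a
      obtain ⟨rfl, rfl⟩ := ih' b
      exact ⟨rfl, rfl⟩
  | ite_true ht _ ih =>
    cases h₂ with
    | ite_true _ a => obtain ⟨rfl, rfl⟩ := ih a; exact ⟨rfl, rfl⟩
    | ite_false hf _ => exact absurd ht hf
  | ite_false hf _ ih =>
    cases h₂ with
    | ite_true ht _ => exact absurd ht hf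
    | ite_false _ a => obtain ⟨rfl, rfl⟩ := ih a; exact ⟨rfl, rfl⟩
  | loop_true ht _ _ ih ih' =>
    cases h₂ with
    | loop_true _ a b =>
      obtain ⟨rfl, rfl⟩ := ih a
      obtain ⟨rfl, rfl⟩ := ih' b
      exact ⟨rfl, rfl⟩
    | loop_false hf => exact absurd ht hf
  | loop_false hf =>
    cases h₂ with
    | loop_true ht _ _ => exact absurd ht hf
    | loop_false _ => exact ⟨rfl, rfl⟩

/-- The initial configuration: the integer words and the real words of the input are in the integer
array and the real array number `0`, and everything else is zero. -/
def initial (ns : List ℕ) (rs : List ℝ) : State where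
  nreg := fun _ => 0
  rreg := fun _ => 0
  nmem := fun m k => if m = 0 then ns.getD k 0 else 0
  rmem := fun m k => if m = 0 then rs.getD k 0 else 0

/-- A parameterised computational problem over the reals: instances, their encoding by integer and
real words, the parameter, and the outputs (integer and real words) that are correct answers. -/
structure ParamProblem where
  Inst : Type
  natInput : Inst → List ℕ
  realInput : Inst → List ℝ
  param : Inst → ℕ
  Correct : Inst → (ℕ → ℕ) → (ℕ → ℝ) → Prop

/-- The size of an instance is the number of words of its encoding. -/
def ParamProblem.size (Q : ParamProblem) (I : Q.Inst) : ℕ :=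
  (Q.natInput I).length + (Q.realInput I).length

/-- One program answers every instance `I` of `Q` correctly after at most `T I` steps; the answer
is read off the integer array and the real array number `1`. -/
def ParamProblem.SolvableInTime (Q : ParamProblem) (T : Q.Inst → ℕ) : Prop :=
  ∃ p : Program, ∀ I : Q.Inst, ∃ (s : State) (n : ℕ),
    Exec p (initial (Q.natInput I) (Q.realInput I)) s n ∧ n ≤ T I ∧
      Q.Correct I (s.nmem 1) (s.rmem 1)

/-- The class XP (slice-wise polynomial): one program solves every instance of parameter `k` and
size `n` in time `f k * n ^ g k`, where `f` and `g` are computable. -/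
def ParamProblem.InXP (Q : ParamProblem) : Prop :=
  ∃ f g : ℕ → ℕ, Computable f ∧ Computable g ∧
    Q.SolvableInTime (fun I => f (Q.param I) * Q.size I ^ g (Q.param I))

end RealRAM

/-! ## Consensus maximisation -/

/-- The data of consensus maximisation: `N` measurements `(a i, b i)` in dimension `d`, and the
inlier threshold `ε`. -/
structure MaxconInstance where
  d : ℕ
  N : ℕ
  a : Fin N → Fin d → ℝ
  b : Fin N → ℝ
  ε : ℝ
  ε_nonneg : 0 ≤ ε

namespace MaxconInstance

/-- The consensus of `x`: the number of measurements whose residual is at most `ε`. -/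
noncomputable def consensus (I : MaxconInstance) (x : Fin I.d → ℝ) : ℕ :=
  ∑ i : Fin I.N, if |I.a i ⬝ᵥ x - I.b i| ≤ I.ε then 1 else 0

/-- The real words `ε, a₁, b₁, …, a_N, b_N` of the input, each `aᵢ` being `d` words. -/
def realWords (I : MaxconInstance) : List ℝ :=
  I.ε :: (List.ofFn fun i => List.ofFn (I.a i) ++ [I.b i]).flatten

end MaxconInstance

/-- MAXCON, parameterised by the dimension: output the coordinates of some `x` of maximum
consensus. -/
def MAXCON : RealRAM.ParamProblem where
  Inst := MaxconInstance
  natInput := fun I => [I.d, I.N]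
  realInput := fun I => I.realWords
  param := fun I => I.d
  Correct := fun I _ out => ∀ y : Fin I.d → ℝ, I.consensus y ≤ I.consensus (fun j => out j)

/-- The data of the decision version: in addition, a positive integer `ψ`. -/
structure MaxconDInstance extends MaxconInstance where
  ψ : ℕ
  ψ_pos : 0 < ψ

/-- MAXCON-D, parameterised by the dimension: decide whether some `x` has consensus at least `ψ`
(the output `1` means yes, the output `0` means no). -/
def MAXCOND : RealRAM.ParamProblem where
  Inst := MaxconDInstance
  natInput := fun I => [I.d, I.N, I.ψ]
  realInput := fun I => I.realWords
  param := fun I => I.d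
  Correct := fun I out _ =>
    ((∃ x : Fin I.d → ℝ, I.ψ ≤ I.consensus x) ∧ out 0 = 1) ∨
      ((¬ ∃ x : Fin I.d → ℝ, I.ψ ≤ I.consensus x) ∧ out 0 = 0)

/-! Each measurement confines its inliers `x` to a strip bounded by the hyperplanes `a i ⬝ᵥ x = b i
± ε`. Let `S` be the inlier set of an optimal point. In the intersection of the strips of `S`,
choose `x` such that the normals of the strips with `x` on the boundary span a space of maximal
dimension. This span contains `a i` for every `i ∈ S`: otherwise `x` can be moved orthogonally to
the span, so that tight strips stay tight, until a further strip of `S` becomes tight and the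
dimension grows (`exists_tight`). A basis of the span chosen among the tight normals gives at most
`d` equations, and every solution `z` satisfies `a i ⬝ᵥ z = a i ⬝ᵥ x` for all `i ∈ S`, hence has
maximum consensus (`exists_tuple_of_maximum`). No general position is needed, and an underdetermined
system may be solved in any way.

It therefore suffices to try all multisets of `d` equations out of the `2 * N` hyperplanes and the
trivial equation `0 = 0`, which serves as padding. There are `(2 * N + d).choose d` of them, written
as weakly increasing tuples and enumerated in decreasing colexicographic order; a rank counts the
remaining ones (`tupleRank_nextTuple`) and none is skipped (`Before.of_nextTuple`). Each system is
solved by Gram-Schmidt orthogonalisation and successive corrections (`runs_solveProg`), the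
consensus of the result is counted (`runs_evalProg`), and the best vector is kept
(`runs_searchProg`). Together with `choose_two_mul_add_le` this costs `poly(d) * max 1 N ^ (d + 1)`
steps.

Programs are verified by a timed Hoare logic `Runs`, in which each rule also supplies the frame
condition `Unchanged`. Integer array `2` holds row addresses and `3` the tuple; real array `1` holds
the best vector, `2` the right hand sides, `3` the orthogonalised rows, `4` the candidate. -/

namespace RealRAM

/-! ## What a program can change -/

/-- The integer register that an instruction writes. -/
def Instr.natRegs : Instr → List ℕ
  | .natConst i _ | .natAdd i _ _ | .natSub i _ _ | .natLoad _ i _ => [i]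
  | _ => []

/-- The real register that an instruction writes. -/
def Instr.realRegs : Instr → List ℕ
  | .realConst i _ | .realAdd i _ _ | .realSub i _ _ | .realMul i _ _ | .realDiv i _ _
  | .realLoad _ i _ => [i]
  | _ => []

/-- The integer array that an instruction writes. -/
def Instr.natArrays : Instr → List ℕ
  | .natStore m _ _ => [m]
  | _ => []

/-- The real array that an instruction writes. -/
def Instr.realArrays : Instr → List ℕ
  | .realStore m _ _ => [m]
  | _ => []

/-- All elements of the lists that `f` attaches to the instructions of a program. -/
def Program.collect (f : Instr → List ℕ) : Program → List ℕ
  | .skip => []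
  | .op e => f e
  | .seq p q | .ite _ p q => p.collect f ++ q.collect f
  | .loop _ p => p.collect f

/-- Registers and arrays that `p` does not write are the same in both states. -/
structure Unchanged (p : Program) (s s' : State) : Prop where
  nreg : ∀ k, k ∉ p.collect Instr.natRegs → s'.nreg k = s.nreg k
  rreg : ∀ k, k ∉ p.collect Instr.realRegs → s'.rreg k = s.rreg k
  nmem : ∀ m, m ∉ p.collect Instr.natArrays → s'.nmem m = s.nmem m
  rmem : ∀ m, m ∉ p.collect Instr.realArrays → s'.rmem m = s.rmem m

theorem Unchanged.refl (p : Program) (s : State) : Unchanged p s s :=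
  ⟨fun _ _ => rfl, fun _ _ => rfl, fun _ _ => rfl, fun _ _ => rfl⟩

theorem Unchanged.trans {p : Program} {s s' s'' : State} (h : Unchanged p s s')
    (h' : Unchanged p s' s'') : Unchanged p s s'' :=
  ⟨fun k hk => (h'.nreg k hk).trans (h.nreg k hk), fun k hk => (h'.rreg k hk).trans (h.rreg k hk),
    fun k hk => (h'.nmem k hk).trans (h.nmem k hk), fun k hk => (h'.rmem k hk).trans (h.rmem k hk)⟩

theorem Unchanged.of_subset {p q : Program} {s s' : State} (h : Unchanged p s s')
    (hs : ∀ f, p.collect f ⊆ q.collect f) : Unchanged q s s' :=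
  ⟨fun k hk => h.nreg k fun hk' => hk (hs _ hk'), fun k hk => h.rreg k fun hk' => hk (hs _ hk'),
    fun k hk => h.nmem k fun hk' => hk (hs _ hk'), fun k hk => h.rmem k fun hk' => hk (hs _ hk')⟩

/-- The frame property: the lists of written registers and arrays are syntactic, so specifications
need to mention only what changes, and the rest follows by checking membership in an explicit list.
-/
theorem Exec.unchanged {p : Program} {s s' : State} {n : ℕ} (h : Exec p s s' n) :
    Unchanged p s s' := by
  induction h with
  | skip s => exact .refl _ s
  | op e s =>
    constructor <;> intro k hk <;> cases e <;>
      simp_all [Program.collect, Instr.natRegs, Instr.realRegs, Instr.natArrays, Instr.realArrays,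
        Instr.apply]
  | seq _ _ ih ih' =>
    exact (ih.of_subset fun f => List.subset_append_left _ _).trans
      (ih'.of_subset fun f => List.subset_append_right _ _)
  | ite_true _ _ ih => exact ih.of_subset fun f => List.subset_append_left _ _
  | ite_false _ _ ih => exact ih.of_subset fun f => List.subset_append_right _ _
  | loop_true _ _ _ ih ih' =>
    exact Unchanged.trans (p := .loop _ _) ⟨ih.nreg, ih.rreg, ih.nmem, ih.rmem⟩ ih'
  | loop_false _ => exact .refl _ _

/-! ## Running times of programs -/

/-- Started in `s`, the program `p` halts after at most `T` steps in a configuration that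
satisfies `Q`. -/
def Runs (p : Program) (s : State) (T : ℕ) (Q : State → Prop) : Prop :=
  ∃ s' n, Exec p s s' n ∧ n ≤ T ∧ Q s'

/-- Straight-line programs. -/
def block : List Instr → Program
  | [] => .skip
  | e :: l => .seq (.op e) (block l)

@[simp] theorem collect_block (f : Instr → List ℕ) (l : List Instr) :
    (block l).collect f = l.flatMap f := by
  induction l with
  | nil => rfl
  | cons e l ih => simp [block, Program.collect, ih]

theorem Runs.mono {p : Program} {s : State} {T T' : ℕ} {Q Q' : State → Prop}
    (h : Runs p s T Q) (hT : T ≤ T') (hQ : ∀ s', Unchanged p s s' → Q s' → Q' s') :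
    Runs p s T' Q' := by
  obtain ⟨s', n, he, hn, hq⟩ := h
  exact ⟨s', n, he, hn.trans hT, hQ _ he.unchanged hq⟩

theorem Runs.skip {s : State} {Q : State → Prop} (h : Q s) : Runs .skip s 1 Q :=
  ⟨s, 1, .skip s, le_rfl, h⟩

theorem Runs.seq {p q : Program} {s : State} {T₁ T₂ : ℕ} {R Q : State → Prop}
    (h₁ : Runs p s T₁ R) (h₂ : ∀ s', Unchanged p s s' → R s' → Runs q s' T₂ Q) :
    Runs (.seq p q) s (T₁ + T₂) Q := by
  obtain ⟨s', n, he, hn, hr⟩ := h₁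
  obtain ⟨s'', n', he', hn', hq⟩ := h₂ s' he.unchanged hr
  exact ⟨s'', n + n', .seq he he', by omega, hq⟩

theorem exec_block (l : List Instr) (s : State) :
    Exec (block l) s (l.foldl (fun s e => e.apply s) s) (l.length + 1) := by
  induction l generalizing s with
  | nil => exact .skip s
  | cons e l ih =>
    have h := Exec.seq (.op e s) (ih (e.apply s))
    rw [List.length_cons, Nat.add_comm l.length 1]
    exact (Nat.add_assoc 1 l.length 1).symm ▸ h

theorem Runs.block {l : List Instr} {s : State} {Q : State → Prop}
    (h : Q (l.foldl (fun s e => e.apply s) s)) : Runs (block l) s (l.length + 1) Q :=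
  ⟨_, _, exec_block l s, le_rfl, h⟩

theorem Runs.ite {t : Test} {p q : Program} {s : State} {T : ℕ} {Q : State → Prop}
    (h₁ : t.Holds s → Runs p s T Q) (h₂ : ¬ t.Holds s → Runs q s T Q) :
    Runs (.ite t p q) s (T + 1) Q := by
  by_cases ht : t.Holds s
  · obtain ⟨s', n, he, hn, hq⟩ := h₁ ht
    exact ⟨s', n + 1, .ite_true ht he, by omega, hq⟩
  · obtain ⟨s', n, he, hn, hq⟩ := h₂ ht
    exact ⟨s', n + 1, .ite_false ht he, by omega, hq⟩

/-- The frame condition refers to a fixed state `s₀` and not to the current one, so that it survives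
the induction on the number of rounds. -/
theorem Runs.loop_down_of_unchanged {t : Test} {p : Program} {T : ℕ} {Inv : ℕ → State → Prop}
    {s₀ : State} (hstep : ∀ k s, Unchanged p s₀ s → Inv (k + 1) s → t.Holds s ∧ Runs p s T (Inv k))
    (hend : ∀ s, Unchanged p s₀ s → Inv 0 s → ¬ t.Holds s) (n : ℕ)
    {s : State} (hs : Unchanged p s₀ s) (h0 : Inv n s) :
    Runs (.loop t p) s (n * (T + 1) + 1) (Inv 0) := by
  induction n generalizing s with
  | zero => exact ⟨s, 1, .loop_false (hend s hs h0), by omega, h0⟩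
  | succ n ih =>
    obtain ⟨ht, s', m, he, hm, hi⟩ := hstep n s hs h0
    obtain ⟨s'', m', he', hm', hi'⟩ := ih (hs.trans he.unchanged) hi
    refine ⟨s'', m + m' + 1, .loop_true ht he he', ?_, hi'⟩
    have : (n + 1) * (T + 1) = n * (T + 1) + (T + 1) := by ring
    omega

/-- The rule for loops with an assertion `Inv k` that holds when `k` rounds are left. -/
theorem Runs.loop_down {t : Test} {p : Program} {T : ℕ} {Inv : ℕ → State → Prop} (n : ℕ)
    {s : State} (h0 : Inv n s)
    (hstep : ∀ k s', Unchanged p s s' → Inv (k + 1) s' → t.Holds s' ∧ Runs p s' T (Inv k))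
    (hend : ∀ s', Unchanged p s s' → Inv 0 s' → ¬ t.Holds s') :
    Runs (.loop t p) s (n * (T + 1) + 1) (Inv 0) :=
  Runs.loop_down_of_unchanged hstep hend n (.refl _ _) h0

/-- The rule for loops with an assertion `Inv k` that holds after `k` rounds. -/
theorem Runs.loop_up {t : Test} {p : Program} {T : ℕ} {Inv : ℕ → State → Prop} (n : ℕ)
    {s : State} (h0 : Inv 0 s)
    (hstep : ∀ k s', k < n → Unchanged p s s' → Inv k s' →
      t.Holds s' ∧ Runs p s' T (Inv (k + 1)))
    (hend : ∀ s', Unchanged p s s' → Inv n s' → ¬ t.Holds s') :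
    Runs (.loop t p) s (n * (T + 1) + 1) (Inv n) := by
  have := Runs.loop_down (t := t) (p := p) (T := T) (s := s)
    (Inv := fun k s => k ≤ n ∧ Inv (n - k) s) n ⟨le_rfl, by simpa using h0⟩
    (fun k s hu hk => by
      obtain ⟨ht, hr⟩ := hstep (n - (k + 1)) s (by omega) hu hk.2
      refine ⟨ht, hr.mono le_rfl fun s' _ hs' => ⟨by omega, ?_⟩⟩
      rwa [show n - k = n - (k + 1) + 1 by omega])
    (fun s hu hs => hend s hu (by simpa using hs.2))
  exact this.mono le_rfl fun s' _ hs' => by simpa using hs'.2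

/-! ## Vector operations

Conventions: the integer registers `0`, `2` and `3` hold the dimension, `1` and `0`, the real
registers `0` and `2` hold `0` and `1`. Subroutines use the registers from `20` on. -/

/-- The inner product of the first `d` coordinates. -/
noncomputable def dot (d : ℕ) (u v : ℕ → ℝ) : ℝ := ∑ i ∈ Finset.range d, u i * v i

/-- Inner product, into real register `20`, of the vectors of the real arrays `m₁` and `m₂` that
start at the addresses in registers `r₁` and `r₂`. -/
def dotProg (m₁ m₂ r₁ r₂ : ℕ) : Program :=
  .seq (block [.natAdd 20 r₁ 3, .natAdd 21 r₂ 3, .natConst 22 1, .realConst 20 0])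
    (.loop (.natLe 22 0) (block [.realLoad m₁ 21 20, .realLoad m₂ 22 21, .realMul 21 21 22,
      .realAdd 20 20 21, .natAdd 20 20 2, .natAdd 21 21 2, .natAdd 22 22 2]))

@[simp] theorem collect_natRegs_dotProg (m₁ m₂ r₁ r₂ : ℕ) :
    (dotProg m₁ m₂ r₁ r₂).collect Instr.natRegs = [20, 21, 22, 20, 21, 22] := rfl

@[simp] theorem collect_realRegs_dotProg (m₁ m₂ r₁ r₂ : ℕ) :
    (dotProg m₁ m₂ r₁ r₂).collect Instr.realRegs = [20, 21, 22, 21, 20] := rfl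

@[simp] theorem collect_natArrays_dotProg (m₁ m₂ r₁ r₂ : ℕ) :
    (dotProg m₁ m₂ r₁ r₂).collect Instr.natArrays = [] := rfl

@[simp] theorem collect_realArrays_dotProg (m₁ m₂ r₁ r₂ : ℕ) :
    (dotProg m₁ m₂ r₁ r₂).collect Instr.realArrays = [] := rfl

theorem runs_dotProg {m₁ m₂ r₁ r₂ : ℕ} {s : State} (hr₂ : r₂ < 20)
    (h2 : s.nreg 2 = 1) (h3 : s.nreg 3 = 0) :
    Runs (dotProg m₁ m₂ r₁ r₂) s (20 * (s.nreg 0 + 1)) (fun s' =>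
      s'.rreg 20 = dot (s.nreg 0) (fun i => s.rmem m₁ (s.nreg r₁ + i))
        (fun i => s.rmem m₂ (s.nreg r₂ + i))) := by
  refine Runs.mono (Runs.seq (R := fun s' => s'.nreg 20 = s.nreg r₁ ∧
      s'.nreg 21 = s.nreg r₂ ∧ s'.nreg 22 = 1 ∧ s'.rreg 20 = 0) (Runs.block ?_)
    (fun s₁ hu ⟨h20, h21, h22, hr⟩ => (Runs.loop_up (T := 8)
      -- Tests only offer `≤`, so the counter starts at `1` and is `k + 1` after `k` rounds; it
      -- exceeds the dimension after exactly that many rounds. The later loops count in the same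
      -- way.
      (Inv := fun k s' => s'.nreg 20 = s.nreg r₁ + k ∧
        s'.nreg 21 = s.nreg r₂ + k ∧ s'.nreg 22 = k + 1 ∧
        s'.rreg 20 = dot k (fun i => s.rmem m₁ (s.nreg r₁ + i))
          (fun i => s.rmem m₂ (s.nreg r₂ + i))) (s.nreg 0)
      ⟨by simpa using h20, by simpa using h21, by simpa using h22, by simpa [dot] using hr⟩
      (fun k s' hk hu' ⟨h20, h21, h22, hr⟩ => ⟨?_, Runs.block ?_⟩) ?_))) ?_
    (fun s' _ hs' => hs'.2.2.2)
  · simp [Instr.apply, Function.update_apply, *]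
    omega
  · have h0 : s'.nreg 0 = s.nreg 0 := by
      rw [hu'.nreg, hu.nreg] <;> simp [Instr.natRegs]
    simp only [Test.Holds]; omega
  · have hn : s'.nreg 2 = s.nreg 2 := by rw [hu'.nreg, hu.nreg] <;> simp [Instr.natRegs]
    have hm : s'.rmem = s.rmem := by
      funext m
      rw [hu'.rmem, hu.rmem] <;> simp [Instr.realArrays]
    simp [Instr.apply, *, dot, Finset.sum_range_succ]
    omega
  · rintro s' hu' ⟨h20, h21, h22, hr⟩
    have h0 : s'.nreg 0 = s.nreg 0 := by
      rw [hu'.nreg, hu.nreg] <;> simp [Instr.natRegs]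
    simp only [Test.Holds]; omega
  · simp
    omega

/-- Linear combination of the vectors of the real arrays `m₁` and `m₂` that start at the addresses
in registers `r₁` and `r₂`, with the coefficients in the real registers `c₁` and `c₂`. It replaces
the first of the two vectors. -/
def combProg (m₁ m₂ r₁ r₂ c₁ c₂ : ℕ) : Program :=
  .seq (block [.natAdd 20 r₁ 3, .natAdd 21 r₂ 3, .natConst 22 1])
    (.loop (.natLe 22 0) (block [.realLoad m₁ 21 20, .realMul 21 21 c₁, .realLoad m₂ 22 21,
      .realMul 22 22 c₂, .realAdd 21 21 22, .realStore m₁ 20 21,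
      .natAdd 20 20 2, .natAdd 21 21 2, .natAdd 22 22 2]))

@[simp] theorem collect_natRegs_combProg (m₁ m₂ r₁ r₂ c₁ c₂ : ℕ) :
    (combProg m₁ m₂ r₁ r₂ c₁ c₂).collect Instr.natRegs = [20, 21, 22, 20, 21, 22] := rfl

@[simp] theorem collect_realRegs_combProg (m₁ m₂ r₁ r₂ c₁ c₂ : ℕ) :
    (combProg m₁ m₂ r₁ r₂ c₁ c₂).collect Instr.realRegs = [21, 21, 22, 22, 21] := rfl

@[simp] theorem collect_natArrays_combProg (m₁ m₂ r₁ r₂ c₁ c₂ : ℕ) :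
    (combProg m₁ m₂ r₁ r₂ c₁ c₂).collect Instr.natArrays = [] := rfl

@[simp] theorem collect_realArrays_combProg (m₁ m₂ r₁ r₂ c₁ c₂ : ℕ) :
    (combProg m₁ m₂ r₁ r₂ c₁ c₂).collect Instr.realArrays = [m₁] := rfl

/-- The first vector is overwritten in place, so the second one must lie in another array or end
before the first begins (`hd`). The register bounds keep the arguments away from the scratch
registers. -/
theorem runs_combProg {m₁ m₂ r₁ r₂ c₁ c₂ : ℕ} {s : State} (hr₂ : r₂ < 20) (hc₁ : c₁ < 20)
    (hc₂ : c₂ < 20) (hd : m₁ ≠ m₂ ∨ s.nreg r₂ + s.nreg 0 ≤ s.nreg r₁)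
    (h2 : s.nreg 2 = 1) (h3 : s.nreg 3 = 0) :
    Runs (combProg m₁ m₂ r₁ r₂ c₁ c₂) s (20 * (s.nreg 0 + 1)) (fun s' =>
      (∀ i < s.nreg 0, s'.rmem m₁ (s.nreg r₁ + i) =
        s.rmem m₁ (s.nreg r₁ + i) * s.rreg c₁ + s.rmem m₂ (s.nreg r₂ + i) * s.rreg c₂) ∧
      ∀ a < s.nreg r₁, s'.rmem m₁ a = s.rmem m₁ a) := by
  refine Runs.mono (Runs.seq (R := fun s' => s'.nreg 20 = s.nreg r₁ ∧
      s'.nreg 21 = s.nreg r₂ ∧ s'.nreg 22 = 1) (Runs.block ?_)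
    (fun s₁ hu ⟨h20, h21, h22⟩ => (Runs.loop_up (T := 10)
      (Inv := fun k s' => s'.nreg 20 = s.nreg r₁ + k ∧
        s'.nreg 21 = s.nreg r₂ + k ∧ s'.nreg 22 = k + 1 ∧
        (∀ i < k, s'.rmem m₁ (s.nreg r₁ + i) =
          s.rmem m₁ (s.nreg r₁ + i) * s.rreg c₁ + s.rmem m₂ (s.nreg r₂ + i) * s.rreg c₂) ∧
        (∀ i ≥ k, s'.rmem m₁ (s.nreg r₁ + i) = s.rmem m₁ (s.nreg r₁ + i)) ∧
        ∀ a < s.nreg r₁, s'.rmem m₁ a = s.rmem m₁ a) (s.nreg 0)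
      ⟨by simpa using h20, by simpa using h21, by simpa using h22, by simp, ?_, ?_⟩
      (fun k s' hk hu' ⟨h20, h21, h22, hlt, hge, hlo⟩ => ⟨?_, Runs.block ?_⟩) ?_))) ?_
    (fun s' _ hs' => ⟨hs'.2.2.2.1, hs'.2.2.2.2.2⟩)
  · simp [Instr.apply, Function.update_apply, *]
    omega
  · intro i _
    rw [hu.rmem]; simp [Instr.realArrays]
  · intro i _
    rw [hu.rmem]; simp [Instr.realArrays]
  · have h0 : s'.nreg 0 = s.nreg 0 := by
      rw [hu'.nreg, hu.nreg] <;> simp [Instr.natRegs]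
    simp only [Test.Holds]; omega
  · have hn : s'.nreg 2 = s.nreg 2 := by rw [hu'.nreg, hu.nreg] <;> simp [Instr.natRegs]
    have hk₁ : s'.rreg c₁ = s.rreg c₁ := by
      rw [hu'.rreg, hu.rreg] <;> simp [Instr.realRegs] <;> omega
    have hk₂ : s'.rreg c₂ = s.rreg c₂ := by
      rw [hu'.rreg, hu.rreg] <;> simp [Instr.realRegs] <;> omega
    have e₁ : c₁ ≠ 21 := by omega
    have e₂ : c₂ ≠ 21 := by omega
    have e₃ : c₂ ≠ 22 := by omega
    -- If both vectors lie in the same array, the entry read is below the region being overwritten,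
    -- by `hd`.
    have hm : s'.rmem m₂ (s.nreg r₂ + k) = s.rmem m₂ (s.nreg r₂ + k) := by
      by_cases hmm : m₂ = m₁
      · subst hmm
        exact hlo _ (by have := hd.resolve_left (by simp); omega)
      · rw [hu'.rmem, hu.rmem] <;> simp [Instr.realArrays, hmm]
    have hm₁ := hge k le_rfl
    refine ⟨?_, ?_, ?_, fun i hi => ?_, fun i hi => ?_, fun a ha => ?_⟩
    · simp [Instr.apply, *]; omega
    · simp [Instr.apply, *]; omega
    · simp [Instr.apply, *]
    · rcases Nat.lt_succ_iff_lt_or_eq.mp hi with hi | rfl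
      · have : i ≠ k := by omega
        simp [Instr.apply, *]
      · simp [Instr.apply, *]
    · have h1 : i ≠ k := by omega
      have h2 : k ≤ i := by omega
      simp [Instr.apply, *]
    · have h1 : a ≠ s.nreg r₁ + k := by omega
      simp [Instr.apply, *]
  · rintro s' hu' ⟨h20, h21, h22, hr⟩
    have h0 : s'.nreg 0 = s.nreg 0 := by
      rw [hu'.nreg, hu.nreg] <;> simp [Instr.natRegs]
    simp only [Test.Holds]; omega
  · simp
    omega

/-! ### Algebra of the inner product: projection and correction. -/

theorem dot_congr {d : ℕ} {u u' v v' : ℕ → ℝ} (hu : ∀ i < d, u i = u' i)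
    (hv : ∀ i < d, v i = v' i) : dot d u v = dot d u' v' :=
  Finset.sum_congr rfl fun i hi => by
    rw [hu i (Finset.mem_range.mp hi), hv i (Finset.mem_range.mp hi)]

theorem dot_comm (d : ℕ) (u v : ℕ → ℝ) : dot d u v = dot d v u :=
  Finset.sum_congr rfl fun _ _ => mul_comm _ _

theorem dot_comb {d : ℕ} {w u v : ℕ → ℝ} {a b : ℝ} (h : ∀ i < d, w i = u i * a + v i * b)
    (y : ℕ → ℝ) : dot d w y = dot d u y * a + dot d v y * b := by
  rw [dot, dot, dot, Finset.sum_mul, Finset.sum_mul, ← Finset.sum_add_distrib]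
  refine Finset.sum_congr rfl fun i hi => ?_
  rw [h i (Finset.mem_range.mp hi)]
  ring

theorem dot_sub_right (d : ℕ) (u v w : ℕ → ℝ) :
    dot d u (fun i => v i - w i) = dot d u v - dot d u w := by
  rw [dot, dot, dot, ← Finset.sum_sub_distrib]
  exact Finset.sum_congr rfl fun i _ => by ring

theorem dot_eq_zero_of_dot_self {d : ℕ} {u : ℕ → ℝ} (h : dot d u u = 0) (y : ℕ → ℝ) :
    dot d u y = 0 := by
  have h' := (Finset.sum_eq_zero_iff_of_nonneg fun i _ => mul_self_nonneg (u i)).mp h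
  exact Finset.sum_eq_zero fun i hi => by rw [mul_self_eq_zero.mp (h' i hi), zero_mul]

/-- If `q` vanishes, the quotient is zero by convention and the product with `q` is zero anyway.
Hence Gram-Schmidt needs no test for linearly dependent rows. -/
theorem dot_project {d : ℕ} {u q w : ℕ → ℝ}
    (h : ∀ i < d, w i = u i * 1 + q i * (0 - dot d u q / dot d q q)) : dot d w q = 0 := by
  rw [dot_comb h]
  by_cases hq : dot d q q = 0
  · rw [hq, dot_comm, dot_eq_zero_of_dot_self hq]; simp
  · field_simp
    ring

/-- One step of the method of successive corrections: if `u` has the same products with `u` and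
`x - x₀` as `a`, then `x` can be moved along `u` to the hyperplane through `x₀` with normal `a`. -/
theorem dot_correct {d : ℕ} {u a x x₀ x' : ℕ → ℝ} (hau : dot d a u = dot d u u)
    (hax : dot d a x - dot d a x₀ = dot d u x - dot d u x₀)
    (h : ∀ i < d, x' i = x i * 1 + u i * ((dot d a x₀ - dot d a x) / dot d a u)) :
    dot d u x' - dot d u x₀ = 0 := by
  rw [dot_comm d u x', dot_comb h, hau, dot_comm d x u]
  by_cases hu : dot d u u = 0
  · rw [hu, dot_eq_zero_of_dot_self hu, dot_eq_zero_of_dot_self hu]; simp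
  · field_simp
    linarith

/-! ### Gram-Schmidt orthogonalisation. -/

/-- The registers that hold constants. -/
structure Consts (s : State) : Prop where
  nat_one : s.nreg 2 = 1
  nat_zero : s.nreg 3 = 0
  real_zero : s.rreg 0 = 0
  real_one : s.rreg 2 = 1

theorem Consts.of_unchanged {p : Program} {s s' : State} (h : Consts s) (hu : Unchanged p s s')
    (h₁ : 2 ∉ p.collect Instr.natRegs ∧ 3 ∉ p.collect Instr.natRegs)
    (h₂ : 0 ∉ p.collect Instr.realRegs ∧ 2 ∉ p.collect Instr.realRegs) : Consts s' :=
  ⟨(hu.nreg 2 h₁.1).trans h.nat_one, (hu.nreg 3 h₁.2).trans h.nat_zero,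
    (hu.rreg 0 h₂.1).trans h.real_zero, (hu.rreg 2 h₂.2).trans h.real_one⟩

/-- The body of the loop of `orthProg`. -/
def orthStep : Program :=
  .seq (dotProg 3 3 12 16) (.seq (block [.realAdd 11 20 0]) (.seq (dotProg 3 3 16 16)
    (.seq (block [.realDiv 11 11 20, .realSub 11 0 11]) (.seq (combProg 3 3 12 16 2 11)
      (block [.natAdd 16 16 0, .natAdd 15 15 2])))))

/-- Makes the vector number `k` of the real array `3` orthogonal to the vectors before it, where
`k` is the content of the integer register `11`. -/
def orthProg : Program :=
  .seq (block [.natConst 15 1, .natConst 16 0]) (.loop (.natLe 15 11) orthStep)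

@[simp] theorem collect_natRegs_orthStep : orthStep.collect Instr.natRegs =
    [20, 21, 22, 20, 21, 22, 20, 21, 22, 20, 21, 22, 20, 21, 22, 20, 21, 22, 16, 15] := rfl

@[simp] theorem collect_realRegs_orthStep : orthStep.collect Instr.realRegs =
    [20, 21, 22, 21, 20, 11, 20, 21, 22, 21, 20, 11, 11, 21, 21, 22, 22, 21] := rfl

@[simp] theorem collect_natArrays_orthStep : orthStep.collect Instr.natArrays = [] := rfl

@[simp] theorem collect_realArrays_orthStep : orthStep.collect Instr.realArrays = [3] := rfl

@[simp] theorem collect_orthProg (f : Instr → List ℕ) :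
    orthProg.collect f = f (.natConst 15 1) ++ (f (.natConst 16 0) ++ orthStep.collect f) := by
  simp [orthProg, Program.collect]

theorem runs_orthStep {s : State} (hc : Consts s) {k j : ℕ} (hjk : j < k)
    (h12 : s.nreg 12 = k * s.nreg 0) (h16 : s.nreg 16 = j * s.nreg 0) (h15 : s.nreg 15 = j + 1) :
    Runs orthStep s (70 * (s.nreg 0 + 1)) (fun s' =>
      s'.nreg 16 = (j + 1) * s.nreg 0 ∧ s'.nreg 15 = j + 2 ∧
      (∀ a < k * s.nreg 0, s'.rmem 3 a = s.rmem 3 a) ∧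
      ∀ i < s.nreg 0, s'.rmem 3 (k * s.nreg 0 + i) = s.rmem 3 (k * s.nreg 0 + i) * 1 +
        s.rmem 3 (j * s.nreg 0 + i) *
        (0 - dot (s.nreg 0) (fun i => s.rmem 3 (k * s.nreg 0 + i))
            (fun i => s.rmem 3 (j * s.nreg 0 + i)) /
          dot (s.nreg 0) (fun i => s.rmem 3 (j * s.nreg 0 + i))
            (fun i => s.rmem 3 (j * s.nreg 0 + i)))) := by
  have hle : j * s.nreg 0 + s.nreg 0 ≤ k * s.nreg 0 := by
    calc _ = (j + 1) * s.nreg 0 := by ring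
      _ ≤ _ := Nat.mul_le_mul_right _ hjk
  set d := s.nreg 0 with hd
  set u := fun i => s.rmem 3 (k * d + i)
  set q := fun i => s.rmem 3 (j * d + i)
  refine Runs.mono (Runs.seq (runs_dotProg (by norm_num) hc.nat_one hc.nat_zero) fun s₁ u₁ h₁ =>
    Runs.seq (R := fun s' => s'.rreg 11 = dot d u q) (Runs.block ?_) fun s₂ u₂ h₂ =>
    Runs.seq (T₁ := 20 * (d + 1)) (R := fun s' => s'.rreg 20 = dot d q q) ?_ fun s₃ u₃ h₃ =>
    Runs.seq (R := fun s' => s'.rreg 11 = 0 - dot d u q / dot d q q) (Runs.block ?_)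
      fun s₄ u₄ h₄ =>
    Runs.seq (T₁ := 20 * (d + 1)) (R := fun s' => (∀ a < k * d, s'.rmem 3 a = s.rmem 3 a) ∧
      ∀ i < d, s'.rmem 3 (k * d + i) = u i * 1 + q i * (0 - dot d u q / dot d q q)) ?_
      fun s₅ u₅ h₅ => Runs.block ?_) ?_ (fun _ _ h => h)
  · have := hc.real_zero
    simp_all [Instr.apply, u₁.rreg]
    rfl
  · have c₂ : Consts s₂ := (hc.of_unchanged u₁ (by simp) (by simp)).of_unchanged u₂
      (by simp [Instr.natRegs]) (by simp [Instr.realRegs])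
    have hn : ∀ i < 20, s₂.nreg i = s.nreg i := fun i hi => by
      rw [u₂.nreg, u₁.nreg] <;> simp [Instr.natRegs] <;> omega
    have hm : s₂.rmem = s.rmem := by
      funext m
      rw [u₂.rmem, u₁.rmem] <;> simp [Instr.realArrays]
    refine (runs_dotProg (by norm_num) c₂.nat_one c₂.nat_zero).mono ?_ fun s' _ h' => h'.trans ?_
    · rw [hn 0 (by norm_num)]
    · rw [hm, hn 0 (by norm_num), hn 16 (by norm_num), h16]
  · have e₁ : s₃.rreg 11 = s₂.rreg 11 := u₃.rreg _ (by simp)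
    have e₀ : s₃.rreg 0 = 0 := by
      rw [u₃.rreg, u₂.rreg, u₁.rreg, hc.real_zero] <;> simp [Instr.realRegs]
    simp [Instr.apply, *]
  · have c₄ : Consts s₄ := (((hc.of_unchanged u₁ (by simp) (by simp)).of_unchanged u₂
      (by simp [Instr.natRegs]) (by simp [Instr.realRegs])).of_unchanged u₃ (by simp)
      (by simp)).of_unchanged u₄ (by simp [Instr.natRegs]) (by simp [Instr.realRegs])
    have hn : ∀ i < 20, s₄.nreg i = s.nreg i := fun i hi => by
      rw [u₄.nreg, u₃.nreg, u₂.nreg, u₁.nreg] <;> simp [Instr.natRegs] <;> omega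
    have hm : s₄.rmem = s.rmem := by
      funext m
      rw [u₄.rmem, u₃.rmem, u₂.rmem, u₁.rmem] <;> simp [Instr.realArrays]
    refine (runs_combProg (by norm_num) (by norm_num) (by norm_num) (Or.inr ?_) c₄.nat_one
      c₄.nat_zero).mono ?_ fun s' _ h' => ?_
    · rw [hn 16 (by norm_num), hn 0 (by norm_num), hn 12 (by norm_num), h12, h16]
      exact hle
    · rw [hn 0 (by norm_num)]
    · rw [hm, hn 0 (by norm_num), hn 16 (by norm_num), h16, hn 12 (by norm_num), h12, h₄,
        c₄.real_one] at h'
      exact ⟨h'.2, h'.1⟩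
  · have hn : ∀ i < 20, s₅.nreg i = s.nreg i := fun i hi => by
      rw [u₅.nreg, u₄.nreg, u₃.nreg, u₂.nreg, u₁.nreg] <;> simp [Instr.natRegs] <;> omega
    have := hc.nat_one
    refine ⟨?_, ?_, ?_, ?_⟩
    · simp [Instr.apply, hn, h16]; ring
    · simp [Instr.apply, *]
    · simpa [Instr.apply] using h₅.1
    · simpa [Instr.apply] using h₅.2
  · simp only [List.length_cons, List.length_nil]
    omega

/-- Only multiples of the earlier vectors are subtracted from vector `k`. They are mutually
orthogonal, so each subtraction preserves the orthogonalities already reached, and products with any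
`y` orthogonal to all of them do not change. The last clause is all that the solver needs to know
about the relation between a row and its orthogonalisation. -/
theorem runs_orthProg {s : State} (hc : Consts s) {k : ℕ} (h11 : s.nreg 11 = k)
    (h12 : s.nreg 12 = k * s.nreg 0)
    (ho : ∀ i < k, ∀ j < k, i ≠ j → dot (s.nreg 0) (fun l => s.rmem 3 (i * s.nreg 0 + l))
      (fun l => s.rmem 3 (j * s.nreg 0 + l)) = 0) :
    Runs orthProg s (80 * (s.nreg 0 + 1) * (k + 1)) (fun s' =>
      (∀ a < k * s.nreg 0, s'.rmem 3 a = s.rmem 3 a) ∧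
      (∀ j < k, dot (s.nreg 0) (fun l => s'.rmem 3 (k * s.nreg 0 + l))
        (fun l => s.rmem 3 (j * s.nreg 0 + l)) = 0) ∧
      ∀ y, (∀ j < k, dot (s.nreg 0) (fun l => s.rmem 3 (j * s.nreg 0 + l)) y = 0) →
        dot (s.nreg 0) (fun l => s'.rmem 3 (k * s.nreg 0 + l)) y =
          dot (s.nreg 0) (fun l => s.rmem 3 (k * s.nreg 0 + l)) y) := by
  refine Runs.mono (Runs.seq (R := fun s' => s'.nreg 15 = 1 ∧ s'.nreg 16 = 0) (Runs.block ?_)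
    fun s₁ u₁ ⟨h15, h16⟩ => Runs.mono (Runs.loop_up (T := 70 * (s.nreg 0 + 1))
      (Inv := fun n s' => s'.nreg 16 = n * s.nreg 0 ∧ s'.nreg 15 = n + 1 ∧
        (∀ a < k * s.nreg 0, s'.rmem 3 a = s.rmem 3 a) ∧
        (∀ j < n, dot (s.nreg 0) (fun l => s'.rmem 3 (k * s.nreg 0 + l))
          (fun l => s.rmem 3 (j * s.nreg 0 + l)) = 0) ∧
        ∀ y, (∀ j < k, dot (s.nreg 0) (fun l => s.rmem 3 (j * s.nreg 0 + l)) y = 0) →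
          dot (s.nreg 0) (fun l => s'.rmem 3 (k * s.nreg 0 + l)) y =
            dot (s.nreg 0) (fun l => s.rmem 3 (k * s.nreg 0 + l)) y) k
      ⟨by simpa using h16, by simpa using h15, ?_, by simp, ?_⟩
      (fun n s' hn hu ⟨g16, g15, hlo, hq, hy⟩ => ⟨?_, ?_⟩) ?_) le_rfl
      fun s' _ hs' => hs'.2.2) ?_ (fun _ _ h => h)
  · simp [Instr.apply]
  · rw [u₁.rmem] <;> simp [Instr.realArrays]
  · rw [u₁.rmem] <;> simp [Instr.realArrays]
  · have e : s'.nreg 11 = s.nreg 11 := by rw [hu.nreg, u₁.nreg] <;> simp [Instr.natRegs]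
    simp only [Test.Holds]; omega
  · have e₀ : s'.nreg 0 = s.nreg 0 := by rw [hu.nreg, u₁.nreg] <;> simp [Instr.natRegs]
    have e₁₂ : s'.nreg 12 = s.nreg 12 := by rw [hu.nreg, u₁.nreg] <;> simp [Instr.natRegs]
    have c' : Consts s' := (hc.of_unchanged u₁ (by simp [Instr.natRegs])
      (by simp [Instr.realRegs])).of_unchanged hu (by simp) (by simp)
    have H := runs_orthStep c' hn (by rw [e₁₂, e₀, h12]) (by rw [e₀, g16]) g15
    rw [e₀] at H
    refine H.mono le_rfl fun s₂ _ ⟨f16, f15, f1, f2⟩ => ?_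
    have hrow : ∀ j < k, ∀ l < s.nreg 0, s'.rmem 3 (j * s.nreg 0 + l) =
        s.rmem 3 (j * s.nreg 0 + l) := fun j hj l hl => by
      refine hlo _ ?_
      calc j * s.nreg 0 + l < j * s.nreg 0 + s.nreg 0 := by omega
        _ = (j + 1) * s.nreg 0 := by ring
        _ ≤ _ := Nat.mul_le_mul_right _ hj
    have f2' : ∀ i < s.nreg 0, (fun l => s₂.rmem 3 (k * s.nreg 0 + l)) i =
        (fun l => s'.rmem 3 (k * s.nreg 0 + l)) i * 1 +
        (fun l => s.rmem 3 (n * s.nreg 0 + l)) i *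
        (0 - dot (s.nreg 0) (fun i => s'.rmem 3 (k * s.nreg 0 + i))
            (fun i => s.rmem 3 (n * s.nreg 0 + i)) /
          dot (s.nreg 0) (fun i => s.rmem 3 (n * s.nreg 0 + i))
            (fun i => s.rmem 3 (n * s.nreg 0 + i))) := fun i hi => by
      simp only
      rw [f2 i hi, hrow n hn i hi, dot_congr (fun _ _ => rfl) (hrow n hn),
        dot_congr (hrow n hn) (hrow n hn)]
    refine ⟨f16, f15, fun a ha => (f1 a ha).trans (hlo a ha), fun j hj => ?_, fun y hy' => ?_⟩
    · rcases Nat.lt_succ_iff_lt_or_eq.mp hj with hj | rfl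
      · rw [dot_comb f2', hq j hj, ho n hn j (hj.trans hn) (by omega)]
        simp
      · exact dot_project f2'
    · rw [dot_comb f2', hy' n hn, hy y hy']
      simp
  · rintro s' hu ⟨-, g15, -⟩
    have e : s'.nreg 11 = s.nreg 11 := by rw [hu.nreg, u₁.nreg] <;> simp [Instr.natRegs]
    simp only [Test.Holds]; omega
  · simp only [List.length_cons, List.length_nil]
    nlinarith [Nat.zero_le (k * s.nreg 0), Nat.zero_le k, Nat.zero_le (s.nreg 0)]

/-! ### Solving a linear system by successive corrections. -/

/-- Entry number `k` of the current tuple selects the row `tupleRow s k` of the input. -/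
noncomputable def tupleRow (s : State) (k : ℕ) : ℕ → ℝ :=
  fun i => s.rmem 0 (s.nmem 2 (s.nmem 3 k) + i)

/-- The right hand side of the equation that is selected by entry number `k` of the current
tuple. -/
noncomputable def tupleRhs (s : State) (k : ℕ) : ℝ := s.rmem 2 (s.nmem 3 k)

/-- The vector number `k` of the real array `3`, where `d` is the dimension. -/
noncomputable def basisVec (d : ℕ) (s : State) (k : ℕ) : ℕ → ℝ := fun i => s.rmem 3 (k * d + i)

/-- The body of the loop of `solveProg`. -/
def solveStep : Program :=
  .seq (block [.natLoad 3 13 11, .natLoad 2 14 13, .realLoad 2 10 13])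
    (.seq (combProg 3 0 12 14 0 2) (.seq orthProg (.seq (dotProg 0 4 14 3)
    (.seq (block [.realSub 10 10 20]) (.seq (dotProg 0 3 14 12)
    (.seq (block [.realDiv 10 10 20]) (.seq (combProg 4 3 3 12 2 10)
    (block [.natAdd 10 10 2, .natAdd 11 11 2, .natAdd 12 12 0]))))))))

/-- Moves the vector in the real array `4` to a solution of the system of equations selected by the
current tuple, if there is one. -/
def solveProg : Program :=
  .seq (block [.natConst 10 1, .natConst 11 0, .natConst 12 0]) (.loop (.natLe 10 0) solveStep)

theorem subset_natRegs_solveStep : solveStep.collect Instr.natRegs ⊆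
    [10, 11, 12, 13, 14, 15, 16, 20, 21, 22] := by
  decide

theorem subset_realRegs_solveStep : solveStep.collect Instr.realRegs ⊆
    [10, 11, 20, 21, 22] := by
  decide

theorem collect_natArrays_solveStep : solveStep.collect Instr.natArrays = [] := by
  simp [solveStep, Program.collect, Instr.natArrays]

theorem subset_realArrays_solveStep : solveStep.collect Instr.realArrays ⊆ [3, 4] := by
  simp [solveStep, Program.collect, Instr.realArrays]

theorem runs_solveStep {s : State} (hc : Consts s) {k d : ℕ} (h0 : s.nreg 0 = d)
    (h11 : s.nreg 11 = k)
    (h10 : s.nreg 10 = k + 1) (h12 : s.nreg 12 = k * d)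
    (ho : ∀ i < k, ∀ j < k, i ≠ j → dot d (basisVec d s i) (basisVec d s j) = 0) :
    Runs solveStep s (180 * (d + 1) * (k + 1)) (fun s' =>
      s'.nreg 10 = k + 2 ∧ s'.nreg 11 = k + 1 ∧ s'.nreg 12 = (k + 1) * d ∧
      (∀ a < k * d, s'.rmem 3 a = s.rmem 3 a) ∧
      (∀ j < k, dot d (basisVec d s' k) (basisVec d s j) = 0) ∧
      (∀ y, (∀ j < k, dot d (basisVec d s j) y = 0) →
        dot d (basisVec d s' k) y = dot d (tupleRow s k) y) ∧
      ∀ i < d, s'.rmem 4 i = s.rmem 4 i * 1 + basisVec d s' k i *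
        ((tupleRhs s k - dot d (tupleRow s k) (s.rmem 4)) /
          dot d (tupleRow s k) (basisVec d s' k))) := by
  refine Runs.mono (Runs.seq (R := fun s' => s'.nreg 14 = s.nmem 2 (s.nmem 3 k) ∧
      s'.rreg 10 = tupleRhs s k) (Runs.block ?_) fun s₁ u₁ ⟨h14, r10⟩ =>
    Runs.seq (T₁ := 20 * (d + 1)) (R := fun s' => (∀ a < k * d, s'.rmem 3 a = s.rmem 3 a) ∧
      ∀ i < d, s'.rmem 3 (k * d + i) = tupleRow s k i) ?_ fun s₂ u₂ ⟨m₂, v₂⟩ =>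
    Runs.seq (T₁ := 80 * (d + 1) * (k + 1)) (R := fun s' =>
      (∀ a < k * d, s'.rmem 3 a = s.rmem 3 a) ∧
      (∀ j < k, dot d (basisVec d s' k) (basisVec d s j) = 0) ∧
      (∀ y, (∀ j < k, dot d (basisVec d s j) y = 0) →
        dot d (basisVec d s' k) y = dot d (tupleRow s k) y)) ?_ fun s₃ u₃ ⟨m₃, o₃, y₃⟩ =>
    Runs.seq (T₁ := 20 * (d + 1)) (R := fun s' => s'.rreg 20 = dot d (tupleRow s k) (s.rmem 4)) ?_
      fun s₄ u₄ r₄ =>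
    Runs.seq (R := fun s' => s'.rreg 10 = tupleRhs s k - dot d (tupleRow s k) (s.rmem 4))
      (Runs.block ?_) fun s₅ u₅ r₅ =>
    Runs.seq (T₁ := 20 * (d + 1)) (R := fun s' =>
      s'.rreg 20 = dot d (tupleRow s k) (basisVec d s₃ k)) ?_ fun s₆ u₆ r₆ =>
    Runs.seq (R := fun s' => s'.rreg 10 = (tupleRhs s k - dot d (tupleRow s k) (s.rmem 4)) /
      dot d (tupleRow s k) (basisVec d s₃ k)) (Runs.block ?_) fun s₇ u₇ r₇ =>
    Runs.seq (T₁ := 20 * (d + 1)) (R := fun s' =>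
      ∀ i < d, s'.rmem 4 i = s.rmem 4 i * 1 + basisVec d s₃ k i *
        ((tupleRhs s k - dot d (tupleRow s k) (s.rmem 4)) /
          dot d (tupleRow s k) (basisVec d s₃ k))) ?_ fun s₈ u₈ f₈ => Runs.block ?_) ?_
      (fun _ _ h => h)
  · simp [Instr.apply, tupleRhs, h11]
  · have c₁ : Consts s₁ := hc.of_unchanged u₁ (by simp [Instr.natRegs]) (by simp [Instr.realRegs])
    have e₀ : s₁.nreg 0 = d := by rw [u₁.nreg, h0]; simp [Instr.natRegs]
    have e₁₂ : s₁.nreg 12 = k * d := by rw [u₁.nreg, h12]; simp [Instr.natRegs]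
    have hm : s₁.rmem = s.rmem := by
      funext m
      rw [u₁.rmem]; simp [Instr.realArrays]
    refine (runs_combProg (by norm_num) (by norm_num) (by norm_num) (Or.inl (by norm_num))
      c₁.nat_one c₁.nat_zero).mono (by rw [e₀]) fun s' _ h' => ?_
    -- With the coefficients `0` and `1` the linear combination is a copy of the selected row.
    rw [e₀, e₁₂, hm, c₁.real_zero, c₁.real_one, h14] at h'
    exact ⟨h'.2, fun i hi => by rw [h'.1 i hi, tupleRow]; ring⟩
  · have c₂ : Consts s₂ := (hc.of_unchanged u₁ (by simp [Instr.natRegs])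
      (by simp [Instr.realRegs])).of_unchanged u₂ (by simp) (by simp)
    have e₀ : s₂.nreg 0 = d := by rw [u₂.nreg, u₁.nreg, h0] <;> simp [Instr.natRegs]
    have e₁₁ : s₂.nreg 11 = k := by rw [u₂.nreg, u₁.nreg, h11] <;> simp [Instr.natRegs]
    have e₁₂ : s₂.nreg 12 = k * d := by rw [u₂.nreg, u₁.nreg, h12] <;> simp [Instr.natRegs]
    have hrow : ∀ j < k, ∀ l < d, basisVec d s₂ j l = basisVec d s j l := fun j hj l hl => by
      refine m₂ _ ?_
      calc j * d + l < j * d + d := by omega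
        _ = (j + 1) * d := by ring
        _ ≤ _ := Nat.mul_le_mul_right _ hj
    have H := runs_orthProg c₂ e₁₁ (by rw [e₁₂, e₀]) fun i hi j hj hij => by
      rw [e₀]
      exact (dot_congr (hrow i hi) (hrow j hj)).trans (ho i hi j hj hij)
    rw [e₀] at H
    refine H.mono le_rfl fun s' _ ⟨g₁, g₂, g₃⟩ => ⟨fun a ha => (g₁ a ha).trans (m₂ a ha),
      fun j hj => (dot_congr (fun _ _ => rfl) (hrow j hj)).symm.trans (g₂ j hj), fun y hy =>
      (g₃ y fun j hj => (dot_congr (hrow j hj) fun _ _ => rfl).trans (hy j hj)).trans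
        (dot_congr v₂ fun _ _ => rfl)⟩
  · have c₃ : Consts s₃ := ((hc.of_unchanged u₁ (by simp [Instr.natRegs])
      (by simp [Instr.realRegs])).of_unchanged u₂ (by simp) (by simp)).of_unchanged u₃
      (by simp [Instr.natRegs]) (by simp [Instr.realRegs])
    have e₀ : s₃.nreg 0 = d := by rw [u₃.nreg, u₂.nreg, u₁.nreg, h0] <;> simp [Instr.natRegs]
    have e₁₄ : s₃.nreg 14 = s.nmem 2 (s.nmem 3 k) := by
      rw [u₃.nreg, u₂.nreg, h14] <;> simp [Instr.natRegs]
    have hm₀ : s₃.rmem 0 = s.rmem 0 := by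
      rw [u₃.rmem, u₂.rmem, u₁.rmem] <;> simp [Instr.realArrays]
    have hm₄ : s₃.rmem 4 = s.rmem 4 := by
      rw [u₃.rmem, u₂.rmem, u₁.rmem] <;> simp [Instr.realArrays]
    refine (runs_dotProg (by norm_num) c₃.nat_one c₃.nat_zero).mono (by rw [e₀]) fun s' _ h' => ?_
    rw [h', e₀, e₁₄, hm₀, hm₄, c₃.nat_zero]
    simp only [zero_add]
    rfl
  · have e₁₀ : s₄.rreg 10 = tupleRhs s k := by
      rw [u₄.rreg, u₃.rreg, u₂.rreg, r10] <;> simp [Instr.realRegs]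
    simp [Instr.apply, *]
  · have c₅ : Consts s₅ := ((((hc.of_unchanged u₁ (by simp [Instr.natRegs])
      (by simp [Instr.realRegs])).of_unchanged u₂ (by simp) (by simp)).of_unchanged u₃
      (by simp [Instr.natRegs]) (by simp [Instr.realRegs])).of_unchanged u₄ (by simp)
      (by simp)).of_unchanged u₅ (by simp [Instr.natRegs]) (by simp [Instr.realRegs])
    have e₀ : s₅.nreg 0 = d := by
      rw [u₅.nreg, u₄.nreg, u₃.nreg, u₂.nreg, u₁.nreg, h0] <;> simp [Instr.natRegs]
    have e₁₂ : s₅.nreg 12 = k * d := by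
      rw [u₅.nreg, u₄.nreg, u₃.nreg, u₂.nreg, u₁.nreg, h12] <;> simp [Instr.natRegs]
    have e₁₄ : s₅.nreg 14 = s.nmem 2 (s.nmem 3 k) := by
      rw [u₅.nreg, u₄.nreg, u₃.nreg, u₂.nreg, h14] <;> simp [Instr.natRegs]
    have hm₀ : s₅.rmem 0 = s.rmem 0 := by
      rw [u₅.rmem, u₄.rmem, u₃.rmem, u₂.rmem, u₁.rmem] <;> simp [Instr.realArrays]
    have hm₃ : s₅.rmem 3 = s₃.rmem 3 := by
      rw [u₅.rmem, u₄.rmem] <;> simp [Instr.realArrays]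
    refine (runs_dotProg (by norm_num) c₅.nat_one c₅.nat_zero).mono (by rw [e₀]) fun s' _ h' => ?_
    rw [h', e₀, e₁₄, hm₀, hm₃, e₁₂]
    rfl
  · have e₁₀ : s₆.rreg 10 = s₅.rreg 10 := by rw [u₆.rreg]; simp
    simp [Instr.apply, *]
  · have c₇ : Consts s₇ := (((((((hc.of_unchanged u₁ (by simp [Instr.natRegs])
      (by simp [Instr.realRegs])).of_unchanged u₂ (by simp) (by simp)).of_unchanged u₃
      (by simp [Instr.natRegs]) (by simp [Instr.realRegs])).of_unchanged u₄ (by simp)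
      (by simp)).of_unchanged u₅ (by simp [Instr.natRegs])
      (by simp [Instr.realRegs]))).of_unchanged u₆ (by simp)
      (by simp)).of_unchanged u₇ (by simp [Instr.natRegs]) (by simp [Instr.realRegs])
    have e₀ : s₇.nreg 0 = d := by
      rw [u₇.nreg, u₆.nreg, u₅.nreg, u₄.nreg, u₃.nreg, u₂.nreg, u₁.nreg, h0] <;>
        simp [Instr.natRegs]
    have e₁₂ : s₇.nreg 12 = k * d := by
      rw [u₇.nreg, u₆.nreg, u₅.nreg, u₄.nreg, u₃.nreg, u₂.nreg, u₁.nreg, h12] <;>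
        simp [Instr.natRegs]
    have hm₄ : s₇.rmem 4 = s.rmem 4 := by
      rw [u₇.rmem, u₆.rmem, u₅.rmem, u₄.rmem, u₃.rmem, u₂.rmem, u₁.rmem] <;>
        simp [Instr.realArrays]
    have hm₃ : s₇.rmem 3 = s₃.rmem 3 := by
      rw [u₇.rmem, u₆.rmem, u₅.rmem, u₄.rmem] <;> simp [Instr.realArrays]
    refine (runs_combProg (by norm_num) (by norm_num) (by norm_num) (Or.inl (by norm_num))
      c₇.nat_one c₇.nat_zero).mono (by rw [e₀]) fun s' _ h' => ?_
    rw [e₀, e₁₂, hm₃, hm₄, c₇.nat_zero, c₇.real_one, r₇] at h'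
    simp only [zero_add] at h'
    exact h'.1
  · have hn : ∀ i < 13, s₈.nreg i = s.nreg i := fun i hi => by
      rw [u₈.nreg, u₇.nreg, u₆.nreg, u₅.nreg, u₄.nreg, u₃.nreg, u₂.nreg, u₁.nreg] <;>
        simp [Instr.natRegs] <;> omega
    have hm₃ : s₈.rmem 3 = s₃.rmem 3 := by
      rw [u₈.rmem, u₇.rmem, u₆.rmem, u₅.rmem, u₄.rmem] <;> simp [Instr.realArrays]
    have hb : ∀ s' : State, s'.rmem = s₈.rmem → basisVec d s' k = basisVec d s₃ k := fun s' h => by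
      funext l
      simp only [basisVec, h, hm₃]
    have := hc.nat_one
    refine ⟨?_, ?_, ?_, ?_, ?_, ?_, ?_⟩
    · simp [Instr.apply, *]
    · simp [Instr.apply, *]
    · simp [Instr.apply, *]; ring
    · simpa [Instr.apply, hm₃] using m₃
    · rw [hb _ (by simp [Instr.apply])]; exact o₃
    · rw [hb _ (by simp [Instr.apply])]; exact y₃
    · rw [hb _ (by simp [Instr.apply])]; simpa [Instr.apply] using f₈
  · simp only [List.length_cons, List.length_nil]
    nlinarith [Nat.zero_le (d * k), Nat.zero_le k, Nat.zero_le d]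

/-- The program does not know `y₀`: a hypothetical solution serves only to state the invariant.
Neither consistency nor independence of the equations is tested, and the initial vector in array `4`
is arbitrary. -/
theorem runs_solveProg {s : State} (hc : Consts s) {d : ℕ} (h0 : s.nreg 0 = d) (y₀ : ℕ → ℝ) :
    Runs solveProg s (200 * (d + 1) ^ 3) (fun s' =>
      (∀ k < d, dot d (tupleRow s k) y₀ = tupleRhs s k) →
        ∀ k < d, dot d (tupleRow s k) (s'.rmem 4) = tupleRhs s k) := by
  refine Runs.mono (Runs.seq (R := fun s' => s'.nreg 10 = 1 ∧ s'.nreg 11 = 0 ∧ s'.nreg 12 = 0)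
    (Runs.block ?_)
    fun s₁ u₁ ⟨h10, h11, h12⟩ => Runs.loop_up (T := 180 * (d + 1) * (d + 1))
      -- After `n` rounds: the first `n` basis vectors are orthogonal; a vector orthogonal to them
      -- is orthogonal to the first `n` rows; and the current point differs from `y₀` by a vector
      -- orthogonal to them, provided `y₀` is a solution.
      (Inv := fun n s' => s'.nreg 10 = n + 1 ∧ s'.nreg 11 = n ∧ s'.nreg 12 = n * d ∧
        (∀ i < n, ∀ j < n, i ≠ j → dot d (basisVec d s' i) (basisVec d s' j) = 0) ∧
        (∀ y, (∀ j < n, dot d (basisVec d s' j) y = 0) → ∀ j < n, dot d (tupleRow s j) y = 0) ∧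
        ((∀ k < d, dot d (tupleRow s k) y₀ = tupleRhs s k) →
          ∀ j < n, dot d (basisVec d s' j) (s'.rmem 4) - dot d (basisVec d s' j) y₀ = 0)) d
      ⟨by simpa using h10, by simpa using h11, by simpa using h12, by simp, by simp, by simp⟩
      (fun n s' hn hu ⟨g10, g11, g12, ho, hS, hX⟩ => ⟨?_, ?_⟩) ?_) ?_
      fun s' _ ⟨_, _, _, ho, hS, hX⟩ hy₀ k hk => ?_
  · simp [Instr.apply]
  · have e₀ : s'.nreg 0 = d := by
      rw [hu.nreg, u₁.nreg, h0]
      · simp [Instr.natRegs]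
      · exact fun h => absurd (subset_natRegs_solveStep h) (by simp)
    simp only [Test.Holds]; omega
  · have e₀ : s'.nreg 0 = d := by
      rw [hu.nreg, u₁.nreg, h0]
      · simp [Instr.natRegs]
      · exact fun h => absurd (subset_natRegs_solveStep h) (by simp)
    have c' : Consts s' := (hc.of_unchanged u₁ (by simp [Instr.natRegs])
      (by simp [Instr.realRegs])).of_unchanged hu
      ⟨fun h => absurd (subset_natRegs_solveStep h) (by simp),
        fun h => absurd (subset_natRegs_solveStep h) (by simp)⟩
      ⟨fun h => absurd (subset_realRegs_solveStep h) (by simp),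
        fun h => absurd (subset_realRegs_solveStep h) (by simp)⟩
    have en : s'.nmem = s.nmem := by
      funext m
      rw [hu.nmem, u₁.nmem] <;> simp [Instr.natArrays, collect_natArrays_solveStep]
    have em : ∀ m < 3, s'.rmem m = s.rmem m := fun m hm => by
      rw [hu.rmem, u₁.rmem]
      · simp [Instr.realArrays]
      · exact fun h => absurd (subset_realArrays_solveStep h) (by simp; omega)
    have hA : tupleRow s' n = tupleRow s n := by
      funext l
      simp only [tupleRow, en, em 0 (by norm_num)]
    have hβ : tupleRhs s' n = tupleRhs s n := by simp only [tupleRhs, en, em 2 (by norm_num)]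
    refine (runs_solveStep c' e₀ g11 g10 g12 ho).mono
      (Nat.mul_le_mul_left _ (by omega)) fun s₂ _ ⟨f10, f11, f12, fm, fo, fy, fx⟩ => ?_
    have hrow : ∀ j < n, ∀ l < d, basisVec d s₂ j l = basisVec d s' j l := fun j hj l hl => by
      refine fm _ ?_
      calc j * d + l < j * d + d := by omega
        _ = (j + 1) * d := by ring
        _ ≤ _ := Nat.mul_le_mul_right _ hj
    rw [hA, hβ] at fx
    rw [hA] at fy
    have hqu : ∀ j < n, dot d (basisVec d s' j) (basisVec d s₂ n) = 0 := fun j hj => by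
      rw [dot_comm]; exact fo j hj
    refine ⟨f10, f11, f12, fun i hi j hj hij => ?_, fun y hy => ?_, fun hy₀ j hj => ?_⟩
    · rcases Nat.lt_succ_iff_lt_or_eq.mp hi with hi | rfl <;>
        rcases Nat.lt_succ_iff_lt_or_eq.mp hj with hj | rfl
      · rw [dot_congr (hrow i hi) (hrow j hj), ho i hi j hj hij]
      · rw [dot_congr (hrow i hi) fun _ _ => rfl, hqu i hi]
      · rw [dot_congr (fun _ _ => rfl) (hrow j hj), fo j hj]
      · exact absurd rfl hij
    · have hy' : ∀ j < n, dot d (basisVec d s' j) y = 0 := fun j hj => by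
        rw [← dot_congr (hrow j hj) fun _ _ => rfl, hy j (by omega)]
      intro j hj
      rcases Nat.lt_succ_iff_lt_or_eq.mp hj with hj | rfl
      · exact hS y hy' j hj
      · rw [← fy y hy', hy j (by omega)]
    -- The right hand side is rewritten as the product of row `n` with `y₀`, which is the form that
    -- `dot_correct` expects. For `j < n` the correction is along a vector orthogonal to basis
    -- vector `j` and has no effect.
    · rw [← hy₀ n hn] at fx
      rcases Nat.lt_succ_iff_lt_or_eq.mp hj with hj | rfl
      · rw [dot_congr (hrow j hj) fun _ _ => rfl, dot_congr (hrow j hj) fun _ _ => rfl,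
          dot_comm d _ (s₂.rmem 4), dot_comb fx, dot_comm d _ (basisVec d s' j),
          dot_comm d (basisVec d s₂ n), hqu j hj]
        linarith [hX hy₀ j hj]
      -- Row `n` and basis vector `n` have equal products with every vector orthogonal to the
      -- earlier basis vectors. This is applied to basis vector `n` itself, and below to the
      -- difference of the current point and `y₀`.
      · refine dot_correct (fy _ hqu).symm ?_ fx
        rw [← dot_sub_right, ← dot_sub_right]
        exact (fy _ fun j hj => by rw [dot_sub_right]; exact hX hy₀ j hj).symm
  · rintro s' hu ⟨g10, -⟩
    have e₀ : s'.nreg 0 = d := by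
      rw [hu.nreg, u₁.nreg, h0]
      · simp [Instr.natRegs]
      · exact fun h => absurd (subset_natRegs_solveStep h) (by simp)
    simp only [Test.Holds]; omega
  · simp only [List.length_cons, List.length_nil]
    nlinarith [Nat.zero_le (d * d), Nat.zero_le d, Nat.zero_le (d ^ 3)]
  · have := hS (fun i => s'.rmem 4 i - y₀ i)
      (fun j hj => by rw [dot_sub_right]; exact hX hy₀ j hj) k hk
    rw [dot_sub_right, hy₀ k hk] at this
    linarith

/-! ## Enumeration of increasing tuples -/

/-- The next tuple in the enumeration, when `j` is the first position with a positive entry. -/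
def nextTuple (j : ℕ) (e : ℕ → ℕ) : ℕ → ℕ := fun i => if i ≤ j then e j - 1 else e i

/-- The number of tuples that are still to come in the enumeration. -/
def tupleRank (d : ℕ) (e : ℕ → ℕ) : ℕ := ∑ i ∈ Finset.range (d + 1), (e i + i).choose (i + 1)

/-- The hockey stick identity; the `1` replaces the missing term with lower index `0`. -/
theorem sum_choose_add_one (v n : ℕ) :
    ∑ i ∈ Finset.range n, (v + i).choose (i + 1) + 1 = (v + n).choose n := by
  induction n with
  | zero => simp
  | succ n ih =>
    rw [Finset.sum_range_succ, add_right_comm, ih, ← add_assoc, Nat.choose_succ_succ]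

/-- Zero entries contribute `i.choose (i + 1) = 0`, so up to position `j` only the term of `e j`
counts. By the hockey stick identity it exceeds the sum of the new terms by one. The rank thus
bounds the rounds of the search. -/
theorem tupleRank_nextTuple {d j : ℕ} {e : ℕ → ℕ} (hj : j ≤ d) (hpos : 0 < e j)
    (hzero : ∀ i < j, e i = 0) : tupleRank d (nextTuple j e) + 1 = tupleRank d e := by
  have hs : ∀ f : ℕ → ℕ, ∑ i ∈ Finset.range (d + 1), f i =
      ∑ i ∈ Finset.range (j + 1), f i + ∑ i ∈ Finset.Ico (j + 1) (d + 1), f i := fun f => by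
    rw [Finset.sum_range_add_sum_Ico _ (by omega)]
  have h₁ : ∑ i ∈ Finset.Ico (j + 1) (d + 1), (nextTuple j e i + i).choose (i + 1) =
      ∑ i ∈ Finset.Ico (j + 1) (d + 1), (e i + i).choose (i + 1) :=
    Finset.sum_congr rfl fun i hi => by
      have := (Finset.mem_Ico.mp hi).1
      rw [nextTuple, if_neg (by omega)]
  have h₂ : ∑ i ∈ Finset.range (j + 1), (nextTuple j e i + i).choose (i + 1) =
      ∑ i ∈ Finset.range (j + 1), (e j - 1 + i).choose (i + 1) :=
    Finset.sum_congr rfl fun i hi => by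
      have := Finset.mem_range.mp hi
      rw [nextTuple, if_pos (by omega)]
  have h₃ : ∑ i ∈ Finset.range (j + 1), (e i + i).choose (i + 1) = (e j + j).choose (j + 1) := by
    rw [Finset.sum_range_succ, Finset.sum_eq_zero, zero_add]
    intro i hi
    rw [hzero i (Finset.mem_range.mp hi), zero_add, Nat.choose_succ_self]
  have h₄ := sum_choose_add_one (e j - 1) (j + 1)
  rw [tupleRank, tupleRank, hs, hs, h₁, h₂, h₃]
  rw [show e j - 1 + (j + 1) = e j + j by omega] at h₄
  omega

/-- The tuples to be enumerated: increasing, with entries at most `K`, and with the entry `1` at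
the end as a sentinel. -/
structure IsTuple (d K : ℕ) (t : ℕ → ℕ) : Prop where
  mono : ∀ i j, i ≤ j → j < d → t i ≤ t j
  le : ∀ i < d, t i ≤ K
  last : t d = 1

/-- The tuple `t` comes before `e` in the enumeration. -/
def Before (d : ℕ) (t e : ℕ → ℕ) : Prop := ∃ i ≤ d, e i < t i ∧ ∀ k, i < k → k ≤ d → t k = e k

/-- No tuple lies strictly between `e` and its successor. Monotonicity of `t` is essential: once `t`
agrees with the successor above some `i ≤ j` and is larger at `i`, it must reach `e j` at position
`j`. -/
theorem Before.of_nextTuple {d K j : ℕ} {e t : ℕ → ℕ} (ht : IsTuple d K t) (hj : j ≤ d)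
    (he : e d ≤ 1) (hpos : 0 < e j) (hzero : ∀ i < j, e i = 0)
    (h : Before d t (nextTuple j e)) : Before d t e ∨ ∀ k ≤ d, t k = e k := by
  obtain ⟨i, hi, hlt, heq⟩ := h
  simp only [nextTuple] at hlt heq
  by_cases hij : j < i
  · refine Or.inl ⟨i, hi, by rwa [if_neg (by omega)] at hlt, fun k hk hkd => ?_⟩
    rw [heq k hk hkd, if_neg (by omega)]
  rw [if_pos (by omega)] at hlt
  have hgt : ∀ k, j < k → k ≤ d → t k = e k := fun k hk hkd => by
    rw [heq k (by omega) hkd, if_neg (by omega)]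
  have htj : e j ≤ t j := by
    rcases (show i = j ∨ i < j by omega) with rfl | hij'
    · omega
    · have h₁ := heq j hij' hj
      rw [if_pos le_rfl] at h₁
      rcases hj.lt_or_eq with hjd | rfl
      · have := ht.mono i j (by omega) hjd
        omega
      · have := ht.last
        omega
  rcases htj.lt_or_eq with htj | htj
  · exact Or.inl ⟨j, hj, htj, hgt⟩
  by_cases hall : ∀ k < j, t k = 0
  · refine Or.inr fun k hk => ?_
    rcases lt_trichotomy k j with hkj | rfl | hkj
    · rw [hall k hkj, hzero k hkj]
    · exact htj.symm
    · exact hgt k hkj hk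
  · push Not at hall
    obtain ⟨k, hkj, hk⟩ := hall
    have hne : ((Finset.range j).filter fun k => t k ≠ 0).Nonempty :=
      ⟨k, by simp [hkj, hk]⟩
    -- Here `t` agrees with `e` from `j` on, and `e` vanishes below `j`; the last nonzero entry of
    -- `t` below `j` decides the comparison.
    set m := Finset.max' _ hne with hm
    have hmem := Finset.mem_filter.mp (Finset.max'_mem _ hne)
    rw [← hm, Finset.mem_range] at hmem
    refine Or.inl ⟨m, by omega, ?_, fun l hl hld => ?_⟩
    · rw [hzero m hmem.1]
      exact Nat.pos_of_ne_zero hmem.2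
    · rcases lt_trichotomy l j with hlj | rfl | hlj
      · rw [hzero l hlj]
        by_contra hne'
        have := Finset.le_max' ((Finset.range j).filter fun k => t k ≠ 0) l (by simp [hlj, hne'])
        omega
      · exact htj.symm
      · exact hgt l hlj hld

/-- Replaces the tuple in the integer array `3` by the next one, and puts the sentinel into the
integer register `6`. -/
def nextProg : Program :=
  .seq (block [.natConst 10 0, .natLoad 3 11 10])
    (.seq (.loop (.natLe 11 3) (block [.natAdd 10 10 2, .natLoad 3 11 10]))
    (.seq (block [.natSub 11 11 2, .natConst 12 0])
    (.seq (.loop (.natLe 12 10) (block [.natStore 3 12 11, .natAdd 12 12 2]))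
    (block [.natLoad 3 6 0]))))

theorem runs_nextProg {s : State} (hc : Consts s) {d j : ℕ} (h0 : s.nreg 0 = d) (hj : j ≤ d)
    (hpos : 0 < s.nmem 3 j) (hzero : ∀ i < j, s.nmem 3 i = 0) :
    Runs nextProg s (30 * (d + 1)) (fun s' =>
      s'.nmem 3 = nextTuple j (s.nmem 3) ∧ s'.nreg 6 = s'.nmem 3 d) := by
  refine Runs.mono (Runs.seq (R := fun s' => s'.nreg 10 = 0 ∧ s'.nreg 11 = s.nmem 3 0)
    (Runs.block ?_) fun s₁ u₁ ⟨h10, h11⟩ => Runs.seq (Runs.loop_up (T := 3)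
      (Inv := fun n s' => s'.nreg 10 = n ∧ s'.nreg 11 = s.nmem 3 n) j ⟨h10, h11⟩
      (fun n s' hn hu ⟨g10, g11⟩ => ⟨?_, Runs.block ?_⟩) ?_)
    fun s₂ u₂ ⟨f10, f11⟩ => Runs.seq (R := fun s' => s'.nreg 11 = s.nmem 3 j - 1 ∧ s'.nreg 12 = 0)
    (Runs.block ?_) fun s₃ u₃ ⟨k11, k12⟩ => Runs.seq (Runs.loop_up (T := 3)
      (Inv := fun n s' => s'.nreg 12 = n ∧
        s'.nmem 3 = fun i => if i < n then s.nmem 3 j - 1 else s.nmem 3 i) (j + 1) ⟨k12, ?_⟩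
      (fun n s' hn hu ⟨g12, gm⟩ => ⟨?_, Runs.block ?_⟩) ?_)
    fun s₄ u₄ ⟨f12, fm⟩ => Runs.block ?_) ?_ (fun _ _ h => h)
  · simp [Instr.apply]
  · have e : s'.nreg 3 = 0 := by
      rw [hu.nreg, u₁.nreg, hc.nat_zero] <;> simp [Instr.natRegs]
    simp only [Test.Holds, e, g11, hzero n hn, le_refl]
  · have e : s'.nreg 2 = 1 := by
      rw [hu.nreg, u₁.nreg, hc.nat_one] <;> simp [Instr.natRegs]
    have em : s'.nmem 3 = s.nmem 3 := by
      rw [hu.nmem, u₁.nmem] <;> simp [Instr.natArrays]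
    simp [Instr.apply, *]
  · rintro s' hu ⟨g10, g11⟩
    have e : s'.nreg 3 = 0 := by
      rw [hu.nreg, u₁.nreg, hc.nat_zero] <;> simp [Instr.natRegs]
    simp only [Test.Holds]; omega
  · have e : s₂.nreg 2 = 1 := by
      rw [u₂.nreg, u₁.nreg, hc.nat_one] <;> simp [Instr.natRegs, Program.collect]
    simp [Instr.apply, *]
  · simp only [Nat.not_lt_zero, if_false]
    rw [u₃.nmem, u₂.nmem, u₁.nmem] <;> simp [Instr.natArrays, Program.collect]
  · have e : s'.nreg 10 = j := by
      rw [hu.nreg, u₃.nreg, f10] <;> simp [Instr.natRegs]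
    simp only [Test.Holds]; omega
  · have e : s'.nreg 2 = 1 := by
      rw [hu.nreg, u₃.nreg, u₂.nreg, u₁.nreg, hc.nat_one] <;> simp [Instr.natRegs, Program.collect]
    have e' : s'.nreg 11 = s.nmem 3 j - 1 := by
      rw [hu.nreg, k11] <;> simp [Instr.natRegs]
    refine ⟨by simp [Instr.apply, *], ?_⟩
    funext i
    rcases lt_trichotomy i n with h | h | h
    · simp [Instr.apply, *, h.ne, show i < n + 1 by omega]
    · simp [Instr.apply, *]
    · simp [Instr.apply, *, h.ne', show ¬ i < n + 1 by omega,
        show ¬ i < n by omega]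
  · rintro s' hu ⟨g12, gm⟩
    have e : s'.nreg 10 = j := by
      rw [hu.nreg, u₃.nreg, f10] <;> simp [Instr.natRegs]
    simp only [Test.Holds]; omega
  · have e : s₄.nreg 0 = d := by
      rw [u₄.nreg, u₃.nreg, u₂.nreg, u₁.nreg, h0] <;> simp [Instr.natRegs, Program.collect]
    constructor
    · funext i
      simp [Instr.apply, fm, nextTuple]
    · simp [Instr.apply, e]
  · simp only [List.length_cons, List.length_nil]
    omega

/-! ## Evaluation of the consensus -/

/-- The number of the first `N` rows of the table whose residual at the vector in the real array
`4` is at most the content of the real register `1`. -/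
noncomputable def inliers (d N : ℕ) (s : State) : ℕ :=
  ∑ i ∈ Finset.range N, if |dot d (fun l => s.rmem 0 (s.nmem 2 i + l)) (s.rmem 4) -
    s.rmem 0 (s.nmem 2 i + d)| ≤ s.rreg 1 then 1 else 0

/-- The body of the loop of `evalProg`. -/
def evalStep : Program :=
  .seq (block [.natLoad 2 14 12]) (.seq (dotProg 0 4 14 3)
    (.seq (block [.natAdd 15 14 0, .realLoad 0 10 15, .realSub 11 20 10, .realSub 12 10 20])
    (.seq (.ite (.realLe 11 1) (.ite (.realLe 12 1) (block [.natAdd 11 11 2]) .skip) .skip)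
    (block [.natAdd 12 12 2, .natAdd 10 10 2]))))

/-- Puts the number of inliers into the integer register `11`. -/
def evalProg : Program :=
  .seq (block [.natConst 11 0, .natConst 12 0, .natConst 10 1]) (.loop (.natLe 10 1) evalStep)

theorem subset_natRegs_evalStep : evalStep.collect Instr.natRegs ⊆
    [10, 11, 12, 14, 15, 20, 21, 22] := by
  decide

theorem subset_realRegs_evalStep : evalStep.collect Instr.realRegs ⊆ [10, 11, 12, 20, 21, 22] := by
  decide

theorem collect_natArrays_evalStep : evalStep.collect Instr.natArrays = [] := rfl

theorem collect_realArrays_evalStep : evalStep.collect Instr.realArrays = [] := rfl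

theorem runs_evalStep {s : State} (hc : Consts s) {d n : ℕ} (h0 : s.nreg 0 = d)
    (h10 : s.nreg 10 = n + 1) (h12 : s.nreg 12 = n) (h11 : s.nreg 11 = inliers d n s) :
    Runs evalStep s (40 * (d + 1)) (fun s' =>
      s'.nreg 10 = n + 2 ∧ s'.nreg 12 = n + 1 ∧ s'.nreg 11 = inliers d (n + 1) s) := by
  refine Runs.mono (Runs.seq (R := fun s' => s'.nreg 14 = s.nmem 2 n) (Runs.block ?_)
    fun s₁ u₁ h14 => Runs.seq (T₁ := 20 * (d + 1)) (R := fun s' => s'.rreg 20 =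
      dot d (fun l => s.rmem 0 (s.nmem 2 n + l)) (s.rmem 4)) ?_ fun s₂ u₂ r20 =>
    Runs.seq (R := fun s' => s'.rreg 11 = dot d (fun l => s.rmem 0 (s.nmem 2 n + l)) (s.rmem 4) -
        s.rmem 0 (s.nmem 2 n + d) ∧ s'.rreg 12 = s.rmem 0 (s.nmem 2 n + d) -
        dot d (fun l => s.rmem 0 (s.nmem 2 n + l)) (s.rmem 4)) (Runs.block ?_)
    fun s₃ u₃ ⟨r11, r12⟩ => Runs.seq (T₁ := 4) (R := fun s' => s'.nreg 11 = inliers d (n + 1) s) ?_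
    fun s₄ u₄ h => Runs.block ?_) ?_ (fun _ _ h => h)
  · simp [Instr.apply, *]
  · have c₁ : Consts s₁ := hc.of_unchanged u₁ (by simp [Instr.natRegs]) (by simp [Instr.realRegs])
    have e₀ : s₁.nreg 0 = d := by rw [u₁.nreg, h0]; simp [Instr.natRegs]
    have hm : s₁.rmem = s.rmem := by
      funext m
      rw [u₁.rmem]; simp [Instr.realArrays]
    refine (runs_dotProg (by norm_num) c₁.nat_one c₁.nat_zero).mono (by rw [e₀]) fun s' _ h' => ?_
    rw [h', e₀, h14, hm, c₁.nat_zero]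
    simp only [zero_add]
  · have e₀ : s₂.nreg 0 = d := by rw [u₂.nreg, u₁.nreg, h0] <;> simp [Instr.natRegs]
    have e₁₄ : s₂.nreg 14 = s.nmem 2 n := by rw [u₂.nreg, h14]; simp
    have hm : s₂.rmem 0 = s.rmem 0 := by rw [u₂.rmem, u₁.rmem] <;> simp [Instr.realArrays]
    simp [Instr.apply, *]
  · have e₂ : s₃.nreg 2 = 1 := by
      rw [u₃.nreg, u₂.nreg, u₁.nreg, hc.nat_one] <;> simp [Instr.natRegs]
    have e₁₁ : s₃.nreg 11 = inliers d n s := by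
      rw [u₃.nreg, u₂.nreg, u₁.nreg, h11] <;> simp [Instr.natRegs]
    have ε₁ : s₃.rreg 1 = s.rreg 1 := by
      rw [u₃.rreg, u₂.rreg, u₁.rreg] <;> simp [Instr.realRegs]
    have hs : inliers d (n + 1) s = inliers d n s +
        if |dot d (fun l => s.rmem 0 (s.nmem 2 n + l)) (s.rmem 4) - s.rmem 0 (s.nmem 2 n + d)| ≤
          s.rreg 1 then 1 else 0 := Finset.sum_range_succ _ _
    -- There is no absolute value instruction: the residual and its negative are both compared with
    -- the threshold.
    refine Runs.ite (T := 3) (fun t₁ => Runs.ite (T := 2) (fun t₂ => Runs.block ?_) fun t₂ => ?_)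
      fun t₁ => ?_
    · simp only [Test.Holds, r11, r12, ε₁] at t₁ t₂
      rw [hs, if_pos (abs_le.mpr ⟨by linarith, t₁⟩)]
      simp [Instr.apply, *]
    · refine (Runs.skip (Q := fun s' => s'.nreg 11 = inliers d (n + 1) s) ?_).mono (by norm_num)
        fun _ _ h => h
      simp only [Test.Holds, r12, ε₁] at t₂
      rw [hs, if_neg fun h => t₂ (by linarith [(abs_le.mp h).1]), e₁₁, add_zero]
    · refine (Runs.skip (Q := fun s' => s'.nreg 11 = inliers d (n + 1) s) ?_).mono (by norm_num)
        fun _ _ h => h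
      simp only [Test.Holds, r11, ε₁] at t₁
      rw [hs, if_neg fun h => t₁ (abs_le.mp h).2, e₁₁, add_zero]
  · have e₂ : s₄.nreg 2 = 1 := by
      rw [u₄.nreg, u₃.nreg, u₂.nreg, u₁.nreg, hc.nat_one] <;> simp [Instr.natRegs, Program.collect]
    have e₁₀ : s₄.nreg 10 = n + 1 := by
      rw [u₄.nreg, u₃.nreg, u₂.nreg, u₁.nreg, h10] <;> simp [Instr.natRegs, Program.collect]
    have e₁₂ : s₄.nreg 12 = n := by
      rw [u₄.nreg, u₃.nreg, u₂.nreg, u₁.nreg, h12] <;> simp [Instr.natRegs, Program.collect]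
    simp [Instr.apply, *]
  · simp only [List.length_cons, List.length_nil]
    omega

theorem runs_evalProg {s : State} (hc : Consts s) {d N : ℕ} (h0 : s.nreg 0 = d)
    (h1 : s.nreg 1 = N) :
    Runs evalProg s (50 * (d + 1) * (N + 1)) (fun s' => s'.nreg 11 = inliers d N s) := by
  refine Runs.mono (Runs.seq (R := fun s' => s'.nreg 10 = 1 ∧ s'.nreg 12 = 0 ∧ s'.nreg 11 = 0)
    (Runs.block ?_) fun s₁ u₁ ⟨h10, h12, h11⟩ => Runs.loop_up (T := 40 * (d + 1))
      (Inv := fun n s' => s'.nreg 10 = n + 1 ∧ s'.nreg 12 = n ∧ s'.nreg 11 = inliers d n s) N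
      ⟨by simpa using h10, by simpa using h12, by simpa [inliers] using h11⟩
      (fun n s' hn hu ⟨g10, g12, g11⟩ => ⟨?_, ?_⟩) ?_) ?_ (fun _ _ h => h.2.2)
  · simp [Instr.apply]
  · have e₁ : s'.nreg 1 = N := by
      rw [hu.nreg, u₁.nreg, h1]
      · simp [Instr.natRegs]
      · exact fun h => absurd (subset_natRegs_evalStep h) (by simp)
    simp only [Test.Holds]; omega
  · have e₀ : s'.nreg 0 = d := by
      rw [hu.nreg, u₁.nreg, h0]
      · simp [Instr.natRegs]
      · exact fun h => absurd (subset_natRegs_evalStep h) (by simp)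
    have c' : Consts s' := (hc.of_unchanged u₁ (by simp [Instr.natRegs])
      (by simp [Instr.realRegs])).of_unchanged hu
      ⟨fun h => absurd (subset_natRegs_evalStep h) (by simp),
        fun h => absurd (subset_natRegs_evalStep h) (by simp)⟩
      ⟨fun h => absurd (subset_realRegs_evalStep h) (by simp),
        fun h => absurd (subset_realRegs_evalStep h) (by simp)⟩
    have em : s'.rmem = s.rmem := by
      funext m
      rw [hu.rmem, u₁.rmem] <;> simp [Instr.realArrays, collect_realArrays_evalStep]
    have en : s'.nmem = s.nmem := by
      funext m
      rw [hu.nmem, u₁.nmem] <;> simp [Instr.natArrays, collect_natArrays_evalStep]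
    have er : s'.rreg 1 = s.rreg 1 := by
      rw [hu.rreg, u₁.rreg]
      · simp [Instr.realRegs]
      · exact fun h => absurd (subset_realRegs_evalStep h) (by simp)
    have hi : ∀ m, inliers d m s' = inliers d m s := fun m => by
      simp only [inliers, em, en, er]
    refine (runs_evalStep c' e₀ g10 g12 (g11.trans (hi n).symm)).mono le_rfl
      fun s₂ _ ⟨f10, f12, f11⟩ => ⟨f10, f12, f11.trans (hi _)⟩
  · rintro s' hu ⟨g10, -⟩
    have e₁ : s'.nreg 1 = N := by
      rw [hu.nreg, u₁.nreg, h1]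
      · simp [Instr.natRegs]
      · exact fun h => absurd (subset_natRegs_evalStep h) (by simp)
    simp only [Test.Holds]; omega
  · simp only [List.length_cons, List.length_nil]
    nlinarith [Nat.zero_le (d * N), Nat.zero_le d, Nat.zero_le N]

end RealRAM

/-! ### Bounding hyperplanes of the strips, and the layout of the input. -/

namespace MaxconInstance

open RealRAM

/-- The coefficients of the measurements, extended by zero. -/
noncomputable def coeff (I : MaxconInstance) (i j : ℕ) : ℝ :=
  if h : i < I.N ∧ j < I.d then I.a ⟨i, h.1⟩ ⟨j, h.2⟩ else 0

/-- The right hand sides of the measurements, extended by zero. -/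
noncomputable def target (I : MaxconInstance) (i : ℕ) : ℝ :=
  if h : i < I.N then I.b ⟨i, h⟩ else 0

/-- The normals of the `2 * N` hyperplanes that bound the strips of the measurements, and a zero
row. -/
noncomputable def row (I : MaxconInstance) (c : ℕ) : ℕ → ℝ :=
  I.coeff (if c < I.N then c else c - I.N)

/-- The right hand sides of the equations with the left hand sides `row`. -/
noncomputable def rhs (I : MaxconInstance) (c : ℕ) : ℝ :=
  if c < I.N then I.target c + I.ε else if c < 2 * I.N then I.target (c - I.N) - I.ε else 0

/-- The vector `x` solves the equations selected by the tuple `t`. -/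
def Solves (I : MaxconInstance) (t : ℕ → ℕ) (x : ℕ → ℝ) : Prop :=
  ∀ k < I.d, dot I.d (I.row (t k)) x = I.rhs (t k)

theorem Solves.congr {I : MaxconInstance} {t e : ℕ → ℕ} {x : ℕ → ℝ} (h : I.Solves e x)
    (hte : ∀ k < I.d, t k = e k) : I.Solves t x := fun k hk => by
  rw [hte k hk]
  exact h k hk

theorem dot_coeff (I : MaxconInstance) (i : Fin I.N) (x : ℕ → ℝ) :
    dot I.d (I.coeff i) x = I.a i ⬝ᵥ fun j : Fin I.d => x j := by
  rw [dotProduct, dot, ← Fin.sum_univ_eq_sum_range (fun j => I.coeff i j * x j)]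
  exact Finset.sum_congr rfl fun j _ => by simp [coeff]

theorem consensus_eq_sum_range (I : MaxconInstance) (x : ℕ → ℝ) :
    I.consensus (fun j => x j) = ∑ i ∈ Finset.range I.N,
      if |dot I.d (I.coeff i) x - I.target i| ≤ I.ε then 1 else 0 := by
  rw [consensus, ← Fin.sum_univ_eq_sum_range (fun i =>
    if |dot I.d (I.coeff i) x - I.target i| ≤ I.ε then 1 else 0)]
  refine Finset.sum_congr rfl fun i _ => ?_
  simp [dot_coeff, target]

theorem realWords_eq (I : MaxconInstance) : I.realWords = I.ε :: List.ofFn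
    (fun k : Fin (I.N * (I.d + 1)) => if k % (I.d + 1) < I.d then
      I.coeff (k / (I.d + 1)) (k % (I.d + 1)) else I.target (k / (I.d + 1))) := by
  rw [realWords, List.ofFn_mul]
  congr 3
  funext i
  rw [List.ofFn_succ_last]
  have hmod : ∀ j < I.d + 1, ((i : ℕ) * (I.d + 1) + j) % (I.d + 1) = j := fun j hj => by
    rw [mul_comm, Nat.mul_add_mod, Nat.mod_eq_of_lt hj]
  have hdiv : ∀ j < I.d + 1, ((i : ℕ) * (I.d + 1) + j) / (I.d + 1) = i := fun j hj => by
    rw [mul_comm, Nat.mul_add_div (Nat.succ_pos _), Nat.div_eq_of_lt hj, add_zero]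
  congr 1
  · congr 1
    funext j
    have hj : (j : ℕ) < I.d + 1 := by omega
    simp [hmod _ hj, hdiv _ hj, coeff]
  · simp [hmod _ (Nat.lt_succ_self _), hdiv _ (Nat.lt_succ_self _), target]

theorem length_realWords (I : MaxconInstance) : I.realWords.length = I.N * (I.d + 1) + 1 := by
  rw [realWords_eq, List.length_cons, List.length_ofFn]

/-- Valid for `i ≥ I.N` as well, where both sides are zero: the words just after the input can serve
as the zero row used for padding. -/
theorem getD_realWords (I : MaxconInstance) {i j : ℕ} (hj : j ≤ I.d) :
    I.realWords.getD (1 + i * (I.d + 1) + j) 0 = if j < I.d then I.coeff i j else I.target i := by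
  have hmod : (i * (I.d + 1) + j) % (I.d + 1) = j := by
    rw [mul_comm, Nat.mul_add_mod, Nat.mod_eq_of_lt (by omega)]
  have hdiv : (i * (I.d + 1) + j) / (I.d + 1) = i := by
    rw [mul_comm, Nat.mul_add_div (Nat.succ_pos _), Nat.div_eq_of_lt (by omega), add_zero]
  rw [realWords_eq, show 1 + i * (I.d + 1) + j = (i * (I.d + 1) + j) + 1 by ring,
    List.getD_cons_succ]
  by_cases hi : i < I.N
  · have hlt : i * (I.d + 1) + j < I.N * (I.d + 1) := by
      calc _ < (i + 1) * (I.d + 1) := by rw [add_mul]; omega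
        _ ≤ _ := Nat.mul_le_mul_right _ hi
    rw [List.getD_eq_getElem _ _ (by simpa using hlt)]
    simp [hmod, hdiv]
  · rw [List.getD_eq_default]
    · simp [coeff, target, hi]
    · rw [List.length_ofFn]
      exact (Nat.mul_le_mul_right _ (not_lt.mp hi)).trans (Nat.le_add_right _ _)

end MaxconInstance

/-! ### Search over all tuples. -/

namespace RealRAM

variable {I : MaxconInstance} {s s' : State}

/-- The state after the tables of rows have been set up. -/
structure Ready (I : MaxconInstance) (s : State) : Prop extends Consts s where
  dim : s.nreg 0 = I.d
  num : s.nreg 1 = I.N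
  eps : s.rreg 1 = I.ε
  row : ∀ c ≤ 2 * I.N, ∀ j < I.d, s.rmem 0 (s.nmem 2 c + j) = I.row c j
  rhs : ∀ c ≤ 2 * I.N, s.rmem 2 c = I.rhs c
  target : ∀ i < I.N, s.rmem 0 (s.nmem 2 i + I.d) = I.target i

theorem Ready.of_unchanged {p : Program} (h : Ready I s) (hu : Unchanged p s s')
    (h₁ : ∀ k < 4, k ∉ p.collect Instr.natRegs) (h₂ : ∀ k < 3, k ∉ p.collect Instr.realRegs)
    (h₃ : 2 ∉ p.collect Instr.natArrays)
    (h₄ : 0 ∉ p.collect Instr.realArrays ∧ 2 ∉ p.collect Instr.realArrays) : Ready I s' where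
  toConsts := h.toConsts.of_unchanged hu ⟨h₁ 2 (by norm_num), h₁ 3 (by norm_num)⟩
    ⟨h₂ 0 (by norm_num), h₂ 2 (by norm_num)⟩
  dim := (hu.nreg _ (h₁ 0 (by norm_num))).trans h.dim
  num := (hu.nreg _ (h₁ 1 (by norm_num))).trans h.num
  eps := (hu.rreg _ (h₂ 1 (by norm_num))).trans h.eps
  row := by rw [hu.nmem 2 h₃, hu.rmem 0 h₄.1]; exact h.row
  rhs := by rw [hu.rmem 2 h₄.2]; exact h.rhs
  target := by rw [hu.nmem 2 h₃, hu.rmem 0 h₄.1]; exact h.target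

theorem Ready.inliers_eq (h : Ready I s) :
    inliers I.d I.N s = I.consensus (fun j => s.rmem 4 j) := by
  rw [I.consensus_eq_sum_range, inliers]
  refine Finset.sum_congr rfl fun i hi => ?_
  have hi := Finset.mem_range.mp hi
  rw [h.target i hi, h.eps, dot_congr (h.row i (by omega)) fun _ _ => rfl, MaxconInstance.row,
    if_pos hi]

theorem Ready.solves_iff (h : Ready I s) (he : ∀ k < I.d, s.nmem 3 k ≤ 2 * I.N) (x : ℕ → ℝ) :
    (∀ k < I.d, dot I.d (tupleRow s k) x = tupleRhs s k) ↔ I.Solves (s.nmem 3) x := by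
  refine forall_congr' fun k => forall_congr' fun hk => ?_
  rw [tupleRhs, h.rhs _ (he k hk),
    dot_congr (u := tupleRow s k) (h.row _ (he k hk)) fun _ _ => rfl]

/-- Computes a solution of the equations selected by the current tuple and replaces the best vector
found so far by it if its consensus is at least as large. The best consensus is in the integer
register `5`, the best vector in the real array `1`. -/
def candidateProg : Program :=
  .seq solveProg (.seq evalProg (.ite (.natLe 5 11)
    (.seq (combProg 1 4 3 3 0 2) (block [.natAdd 5 11 3])) .skip))

theorem subset_natRegs_candidateProg : candidateProg.collect Instr.natRegs ⊆
    [5, 10, 11, 12, 13, 14, 15, 16, 20, 21, 22] := by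
  decide

theorem subset_realRegs_candidateProg : candidateProg.collect Instr.realRegs ⊆
    [10, 11, 12, 20, 21, 22] := by
  decide

theorem collect_natArrays_candidateProg : candidateProg.collect Instr.natArrays = [] := rfl

theorem subset_realArrays_candidateProg : candidateProg.collect Instr.realArrays ⊆ [1, 3, 4] := by
  decide

theorem subset_natRegs_solveProg : solveProg.collect Instr.natRegs ⊆
    [10, 11, 12, 13, 14, 15, 16, 20, 21, 22] := by
  decide

theorem subset_realRegs_solveProg : solveProg.collect Instr.realRegs ⊆ [10, 11, 20, 21, 22] := by
  decide

theorem collect_natArrays_solveProg : solveProg.collect Instr.natArrays = [] := rfl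

theorem subset_realArrays_solveProg : solveProg.collect Instr.realArrays ⊆ [3, 4] := by
  decide

theorem subset_natRegs_evalProg : evalProg.collect Instr.natRegs ⊆
    [10, 11, 12, 14, 15, 20, 21, 22] := by
  decide

theorem subset_realRegs_evalProg : evalProg.collect Instr.realRegs ⊆ [10, 11, 12, 20, 21, 22] := by
  decide

theorem collect_natArrays_evalProg : evalProg.collect Instr.natArrays = [] := rfl

theorem collect_realArrays_evalProg : evalProg.collect Instr.realArrays = [] := rfl

theorem Ready.of_subset {p : Program} (h : Ready I s) (hu : Unchanged p s s')
    (h₁ : p.collect Instr.natRegs ⊆ [5, 10, 11, 12, 13, 14, 15, 16, 20, 21, 22])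
    (h₂ : p.collect Instr.realRegs ⊆ [10, 11, 12, 20, 21, 22])
    (h₃ : p.collect Instr.natArrays = [])
    (h₄ : p.collect Instr.realArrays ⊆ [1, 3, 4]) : Ready I s' :=
  h.of_unchanged hu (fun k hk h => absurd (h₁ h) (by simp; omega))
    (fun k hk h => absurd (h₂ h) (by simp; omega)) (by rw [h₃]; simp)
    ⟨fun h => absurd (h₄ h) (by simp), fun h => absurd (h₄ h) (by simp)⟩

/-- An inconsistent system does no harm: whatever vector results, its consensus is counted for that
very vector, so register `5` never exceeds the consensus of the stored one. -/
theorem runs_candidateProg (h : Ready I s) (he : ∀ k < I.d, s.nmem 3 k ≤ 2 * I.N)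
    (hb : s.nreg 5 ≤ I.consensus (fun j => s.rmem 1 j)) :
    Runs candidateProg s (300 * (I.d + 1) ^ 3 * (I.N + 1)) (fun s' =>
      s.nreg 5 ≤ s'.nreg 5 ∧ s'.nreg 5 ≤ I.consensus (fun j => s'.rmem 1 j) ∧
      ((∃ y, I.Solves (s.nmem 3) y) →
        ∃ x, I.Solves (s.nmem 3) x ∧ I.consensus (fun j => x j) ≤ s'.nreg 5)) := by
  -- `runs_solveProg` needs its reference point before solvability is known, so an arbitrary one is
  -- supplied in the unsolvable case.
  obtain ⟨y₀, hy₀⟩ : ∃ y₀, (∃ y, I.Solves (s.nmem 3) y) → I.Solves (s.nmem 3) y₀ := by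
    by_cases hex : ∃ y, I.Solves (s.nmem 3) y
    · obtain ⟨y, hy⟩ := hex
      exact ⟨y, fun _ => hy⟩
    · exact ⟨0, fun h => absurd h hex⟩
  refine Runs.mono (Runs.seq (runs_solveProg h.toConsts h.dim y₀) fun s₁ u₁ h₁ =>
    Runs.seq (T₁ := 50 * (I.d + 1) * (I.N + 1)) (R := fun s' =>
      s'.nreg 11 = I.consensus (fun j => s₁.rmem 4 j)) ?_ fun s₂ u₂ h₂ =>
    Runs.ite (T := 20 * (I.d + 1) + 4) ?_ ?_) ?_ (Q := fun s' =>
      s.nreg 5 ≤ s'.nreg 5 ∧ s'.nreg 5 ≤ I.consensus (fun j => s'.rmem 1 j) ∧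
        ((∃ y, I.Solves (s.nmem 3) y) →
        ∃ x, I.Solves (s.nmem 3) x ∧ I.consensus (fun j => x j) ≤ s'.nreg 5)) (fun _ _ h => h)
  · have r₁ : Ready I s₁ := h.of_subset u₁
      (List.Subset.trans subset_natRegs_solveProg (by decide))
      (List.Subset.trans subset_realRegs_solveProg (by decide)) collect_natArrays_solveProg
      (List.Subset.trans subset_realArrays_solveProg (by decide))
    exact (runs_evalProg r₁.toConsts r₁.dim r₁.num).mono le_rfl
      fun s' _ h' => h'.trans r₁.inliers_eq
  rotate_right
  · have h₁ : (I.d + 1) * (I.N + 1) ≤ (I.d + 1) ^ 3 * (I.N + 1) :=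
      Nat.mul_le_mul_right _ (Nat.le_self_pow (by norm_num) _)
    have h₂ : (I.d + 1) ^ 3 * 1 ≤ (I.d + 1) ^ 3 * (I.N + 1) := Nat.mul_le_mul_left _ (by omega)
    have h₃ : (I.d + 1) * 1 ≤ (I.d + 1) * (I.N + 1) := Nat.mul_le_mul_left _ (by omega)
    nlinarith
  all_goals
    intro ht
    have hsol : (∃ y, I.Solves (s.nmem 3) y) → I.Solves (s.nmem 3) (s₁.rmem 4) := fun hex =>
      (h.solves_iff he _).mp (h₁ ((h.solves_iff he _).mpr (hy₀ hex)))
    have r₂ : Ready I s₂ := (h.of_subset u₁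
      (List.Subset.trans subset_natRegs_solveProg (by decide))
      (List.Subset.trans subset_realRegs_solveProg (by decide)) collect_natArrays_solveProg
      (List.Subset.trans subset_realArrays_solveProg (by decide))).of_subset u₂
      (List.Subset.trans subset_natRegs_evalProg (by decide)) subset_realRegs_evalProg
      collect_natArrays_evalProg (by rw [collect_realArrays_evalProg]; simp)
    have e₅ : s₂.nreg 5 = s.nreg 5 := by
      rw [u₂.nreg, u₁.nreg]
      · exact fun h => absurd (subset_natRegs_solveProg h) (by simp)
      · exact fun h => absurd (subset_natRegs_evalProg h) (by simp)
    simp only [Test.Holds, h₂, e₅] at ht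
  · have e₄ : s₂.rmem 4 = s₁.rmem 4 := by
      rw [u₂.rmem]
      simp [collect_realArrays_evalProg]
    refine (Runs.seq (T₁ := 20 * (I.d + 1)) (R := fun s' => ∀ i < I.d, s'.rmem 1 i = s₁.rmem 4 i)
      ?_ fun s₃ u₃ h₃ => Runs.block (l := [.natAdd 5 11 3]) (Q := fun s' =>
        s'.nreg 5 = I.consensus (fun j => s₁.rmem 4 j) ∧ ∀ i < I.d, s'.rmem 1 i = s₁.rmem 4 i)
      ?_).mono ?_ fun s' _ ⟨g₁, g₂⟩ => ?_
    · refine (runs_combProg (by norm_num) (by norm_num) (by norm_num) (Or.inl (by norm_num))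
        r₂.nat_one r₂.nat_zero).mono (by rw [r₂.dim]) fun s' _ h' i hi => ?_
      have := h'.1 i (by rw [r₂.dim]; exact hi)
      rw [r₂.nat_zero, r₂.real_zero, r₂.real_one, zero_add, e₄] at this
      rw [this]
      ring
    · have e₃ : s₃.nreg 3 = 0 := by rw [u₃.nreg, r₂.nat_zero]; simp
      have e₁₁ : s₃.nreg 11 = s₂.nreg 11 := by rw [u₃.nreg]; simp
      simpa [Instr.apply, *] using h₃
    · simp
    · have : (fun j : Fin I.d => s'.rmem 1 j) = fun j : Fin I.d => s₁.rmem 4 j :=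
        funext fun j => g₂ j j.2
      rw [g₁, this]
      exact ⟨ht, le_rfl, fun hex => ⟨_, hsol hex, le_rfl⟩⟩
  · have e₁ : s₂.rmem 1 = s.rmem 1 := by
      rw [u₂.rmem, u₁.rmem]
      · exact fun h => absurd (subset_realArrays_solveProg h) (by simp)
      · simp [collect_realArrays_evalProg]
    exact (Runs.skip (by
      rw [e₅, e₁]
      exact ⟨le_rfl, hb, fun hex => ⟨_, hsol hex, (not_le.mp ht).le⟩⟩)).mono (by omega)
      fun _ _ h => h

/-- Runs through all the tuples. -/
def searchProg : Program := .loop (.natLe 2 6) (.seq candidateProg nextProg)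

theorem collect_natRegs_nextProg : nextProg.collect Instr.natRegs =
    [10, 11, 10, 11, 11, 12, 12, 6] := rfl

theorem collect_realRegs_nextProg : nextProg.collect Instr.realRegs = [] := rfl

theorem collect_natArrays_nextProg : nextProg.collect Instr.natArrays = [3] := rfl

theorem collect_realArrays_nextProg : nextProg.collect Instr.realArrays = [] := rfl

theorem runs_searchProg (h : Ready I s) (he : ∀ k < I.d, s.nmem 3 k = 2 * I.N)
    (hd : s.nmem 3 I.d = 1) (h6 : s.nreg 6 = 1)
    (hb : s.nreg 5 ≤ I.consensus (fun j => s.rmem 1 j)) :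
    Runs searchProg s ((2 * I.N + I.d).choose I.d * (400 * (I.d + 1) ^ 3 * (I.N + 1)) + 1)
      (fun s' => s'.nreg 5 ≤ I.consensus (fun j => s'.rmem 1 j) ∧ s'.nreg 2 = 1 ∧
        ∀ t, IsTuple I.d (2 * I.N) t → (∃ y, I.Solves t y) →
          ∃ x, I.Solves t x ∧ I.consensus (fun j => x j) ≤ s'.nreg 5) := by
  have hT : 300 * (I.d + 1) ^ 3 * (I.N + 1) + 30 * (I.d + 1) + 1 ≤
      400 * (I.d + 1) ^ 3 * (I.N + 1) := by
    have h₁ : (I.d + 1) * 1 ≤ (I.d + 1) ^ 3 * (I.N + 1) :=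
      Nat.mul_le_mul (Nat.le_self_pow (by norm_num) _) (by omega)
    nlinarith
  -- The number of rounds left is the rank of the current tuple. Every solvable tuple before the
  -- current one already has a solution whose consensus is at most the recorded best. The sentinel
  -- is `1` until the all-zero tuple has been processed; then position `d` is the first positive one
  -- and it drops to `0`.
  refine (Runs.loop_down (T := 300 * (I.d + 1) ^ 3 * (I.N + 1) + 30 * (I.d + 1)) (Inv := fun n s' =>
    Ready I s' ∧ s'.nreg 5 ≤ I.consensus (fun j => s'.rmem 1 j) ∧ s'.nreg 6 = s'.nmem 3 I.d ∧
      s'.nmem 3 I.d ≤ 1 ∧ (∀ k < I.d, s'.nmem 3 k ≤ 2 * I.N) ∧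
      (s'.nmem 3 I.d = 0 → ∀ k < I.d, s'.nmem 3 k = 0) ∧ tupleRank I.d (s'.nmem 3) = n ∧
      ∀ t, IsTuple I.d (2 * I.N) t → Before I.d t (s'.nmem 3) → (∃ y, I.Solves t y) →
        ∃ x, I.Solves t x ∧ I.consensus (fun j => x j) ≤ s'.nreg 5)
    ((2 * I.N + I.d).choose I.d) ⟨h, hb, h6.trans hd.symm, hd.le, fun k hk => (he k hk).le,
      fun h0 => by omega, ?_, ?_⟩ (fun n s' _ ⟨g, gb, g6, gd, ge, gz, gr, gt⟩ => ?_) ?_).mono ?_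
    fun s' _ ⟨g, gb, g6, gd, ge, gz, gr, gt⟩ => ⟨gb, g.nat_one, fun t ht => gt t ht ?_⟩
  · rw [tupleRank, Finset.sum_range_succ, hd, add_comm 1 I.d, Nat.choose_self,
      ← sum_choose_add_one]
    congr 1
    exact Finset.sum_congr rfl fun i hi => by rw [he i (Finset.mem_range.mp hi)]
  -- Nothing comes before the initial tuple, whose entries have the largest admissible value.
  · rintro t ht ⟨i, hi, hlt, -⟩
    rcases hi.lt_or_eq with hi | rfl
    · have := ht.le i hi
      have := he i hi
      omega
    · have := ht.last
      omega
  · have hpos : 0 < s'.nmem 3 I.d := by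
      by_contra h0
      have h0 : s'.nmem 3 I.d = 0 := by omega
      have : tupleRank I.d (s'.nmem 3) = 0 := Finset.sum_eq_zero fun i hi => by
        have hi := Finset.mem_range_succ_iff.mp hi
        have : s'.nmem 3 i = 0 := by
          rcases hi.lt_or_eq with hi | rfl
          · exact gz h0 i hi
          · exact h0
        rw [this, zero_add, Nat.choose_succ_self]
      omega
    refine ⟨by simp only [Test.Holds, g.nat_one]; omega, ?_⟩
    have hex : ∃ j, 0 < s'.nmem 3 j := ⟨_, hpos⟩
    obtain ⟨j, hj, hjpos, hjz⟩ : ∃ j ≤ I.d, 0 < s'.nmem 3 j ∧ ∀ i < j, s'.nmem 3 i = 0 :=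
      ⟨Nat.find hex, Nat.find_min' hex hpos, Nat.find_spec hex, fun i hi => by
        have := Nat.find_min hex hi
        omega⟩
    refine Runs.seq (runs_candidateProg g ge gb) fun s₁ u₁ ⟨f₁, f₂, f₃⟩ => ?_
    have r₁ : Ready I s₁ := g.of_subset u₁ subset_natRegs_candidateProg
      subset_realRegs_candidateProg collect_natArrays_candidateProg subset_realArrays_candidateProg
    have em : s₁.nmem 3 = s'.nmem 3 := u₁.nmem _ (by simp [collect_natArrays_candidateProg])
    refine (runs_nextProg r₁.toConsts r₁.dim hj (by rwa [em]) (by rwa [em])).mono le_rfl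
      fun s₂ u₂ ⟨k₁, k₂⟩ => ?_
    rw [em] at k₁
    have e₅ : s₂.nreg 5 = s₁.nreg 5 := u₂.nreg _ (by simp [collect_natRegs_nextProg])
    have e₁ : s₂.rmem 1 = s₁.rmem 1 := u₂.rmem _ (by simp [collect_realArrays_nextProg])
    rw [k₁] at k₂
    rw [k₁, e₅, e₁]
    refine ⟨r₁.of_unchanged u₂ (fun k hk => by rw [collect_natRegs_nextProg]; simp; omega)
      (by simp [collect_realRegs_nextProg]) (by simp [collect_natArrays_nextProg])
      (by simp [collect_realArrays_nextProg]), f₂, k₂, ?_, fun k hk => ?_, fun h0 k hk => ?_, ?_,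
      fun t ht hbef hsol => ?_⟩
    · simp only [nextTuple]
      split_ifs with hdj
      · have : j = I.d := by omega
        subst this
        omega
      · exact gd
    · simp only [nextTuple]
      split_ifs with hkj
      · rcases hj.lt_or_eq with hjd | rfl
        · have := ge j hjd
          omega
        · omega
      · exact ge k hk
    · simp only [nextTuple] at h0 ⊢
      have hdj : I.d ≤ j := by
        by_contra hdj
        rw [if_neg hdj] at h0
        omega
      rw [if_pos hdj] at h0
      rw [if_pos (by omega), h0]
    · have := tupleRank_nextTuple hj hjpos hjz
      omega
    · rcases hbef.of_nextTuple ht hj gd hjpos hjz with hbef | heq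
      · obtain ⟨x, hx, hxc⟩ := gt t ht hbef hsol
        exact ⟨x, hx, hxc.trans f₁⟩
      · obtain ⟨y, hy⟩ := hsol
        obtain ⟨x, hx, hxc⟩ := f₃ ⟨y, hy.congr fun k hk => (heq k hk.le).symm⟩
        exact ⟨x, hx.congr fun k hk => heq k hk.le, hxc⟩
  · rintro s' _ ⟨g, gb, g6, gd, ge, gz, gr, gt⟩ ht
    simp only [Test.Holds, g.nat_one, g6] at ht
    have hone : s'.nmem 3 I.d = 1 := by omega
    rw [tupleRank, Finset.sum_range_succ, hone, add_comm 1 I.d, Nat.choose_self] at gr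
    omega
  · exact Nat.add_le_add_right (Nat.mul_le_mul_left _ hT) _
  -- At the end the sentinel is `0`, so every tuple, having `1` there, has been passed.
  · refine ⟨I.d, le_rfl, ?_, fun k hk hk' => by omega⟩
    rw [ht.last]
    by_contra hne
    have hone : s'.nmem 3 I.d = 1 := by omega
    rw [tupleRank, Finset.sum_range_succ, hone, add_comm 1 I.d, Nat.choose_self] at gr
    omega

end RealRAM

/-! ### Initialisation and the complete programs. -/

namespace RealRAM

variable {I : MaxconInstance} {s s' : State}

/-- An initial configuration with the input `I`, and possibly with further integer words. -/
structure Start (I : MaxconInstance) (s : State) : Prop where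
  nreg : ∀ k, s.nreg k = 0
  rreg : ∀ k, s.rreg k = 0
  dim : s.nmem 0 0 = I.d
  num : s.nmem 0 1 = I.N
  input : ∀ k, s.rmem 0 k = I.realWords.getD k 0
  rhs : ∀ k, s.rmem 2 k = 0

/-- The body of the loop of `tableProg`. -/
def tableStep : Program :=
  block [.natStore 2 12 11, .natStore 2 13 11, .natAdd 14 11 0, .realLoad 0 10 14,
    .realAdd 11 10 1, .realStore 2 12 11, .realSub 11 10 1, .realStore 2 13 11,
    .natAdd 11 14 2, .natAdd 12 12 2, .natAdd 13 13 2, .natAdd 10 10 2]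

/-- Sets up the table of rows and right hand sides. -/
def tableProg : Program :=
  .seq (block [.natConst 2 1, .natLoad 0 0 3, .natLoad 0 1 2, .realLoad 0 1 3, .realConst 2 1,
    .natAdd 4 1 1, .natConst 6 1, .natConst 10 1, .natConst 11 1, .natConst 12 0, .natAdd 13 1 3])
    (.seq (.loop (.natLe 10 1) tableStep) (block [.natStore 2 4 11]))

/-- Sets up the first tuple. -/
def firstProg : Program :=
  .seq (block [.natConst 10 1, .natConst 12 0])
    (.seq (.loop (.natLe 10 0) (block [.natStore 3 12 4, .natAdd 12 12 2, .natAdd 10 10 2]))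
    (block [.natStore 3 0 2]))

theorem subset_natRegs_tableStep : tableStep.collect Instr.natRegs ⊆ [10, 11, 12, 13, 14] := by
  decide

theorem subset_realRegs_tableStep : tableStep.collect Instr.realRegs ⊆ [10, 11] := by
  decide

theorem collect_realArrays_tableStep : tableStep.collect Instr.realArrays = [2, 2] := rfl

theorem runs_tableStep {a n N : ℕ} {b : ℝ} (hn : n < N) (h2 : s.nreg 2 = 1)
    (h10 : s.nreg 10 = n + 1) (h11 : s.nreg 11 = a) (h12 : s.nreg 12 = n)
    (h13 : s.nreg 13 = N + n) (hb : s.rmem 0 (a + s.nreg 0) = b) :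
    Runs tableStep s 13 (fun s' =>
      s'.nreg 10 = n + 2 ∧ s'.nreg 11 = a + s.nreg 0 + 1 ∧ s'.nreg 12 = n + 1 ∧
      s'.nreg 13 = N + n + 1 ∧
      (∀ c, s'.nmem 2 c = if c = n ∨ c = N + n then a else s.nmem 2 c) ∧
      (∀ c, s'.rmem 2 c = if c = n then b + s.rreg 1 else if c = N + n then b - s.rreg 1 else
        s.rmem 2 c)) := by
  have hne : n ≠ N + n := by omega
  refine Runs.block ⟨?_, ?_, ?_, ?_, fun c => ?_, fun c => ?_⟩
  · simp [Instr.apply, *]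
  · simp [Instr.apply, *]
  · simp [Instr.apply, *]
  · simp [Instr.apply, *]
  · by_cases h₁ : c = N + n
    · simp [Instr.apply, *]
    · by_cases h₂ : c = n <;> simp [Instr.apply, Function.update_apply, *]
  · by_cases h₁ : c = n
    · subst h₁
      simp [Instr.apply, Function.update_apply, *]
      intro h
      omega
    · by_cases h₂ : c = N + n
      · simp [Instr.apply, *]
        intro h
        omega
      · simp [Instr.apply, *]

theorem runs_tableProg (h : Start I s) :
    Runs tableProg s (20 * (I.N + 1)) (fun s' =>
      Ready I s' ∧ s'.nreg 4 = 2 * I.N ∧ s'.nreg 6 = 1) := by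
  refine Runs.mono (Runs.seq (R := fun s' => s'.nreg 0 = I.d ∧ s'.nreg 1 = I.N ∧ s'.nreg 2 = 1 ∧
      s'.nreg 4 = 2 * I.N ∧ s'.nreg 6 = 1 ∧ s'.nreg 10 = 1 ∧ s'.nreg 11 = 1 ∧ s'.nreg 12 = 0 ∧
      s'.nreg 13 = I.N ∧ s'.rreg 1 = I.ε ∧ s'.rreg 2 = 1) (Runs.block ?_)
    fun s₁ u₁ ⟨h0, h1, h2, h4, h6, h10, h11, h12, h13, r1, r2⟩ => Runs.seq (Runs.loop_up (T := 13)
      (Inv := fun n s' => s'.nreg 10 = n + 1 ∧ s'.nreg 11 = 1 + n * (I.d + 1) ∧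
        s'.nreg 12 = n ∧ s'.nreg 13 = I.N + n ∧
        (∀ c < n, s'.nmem 2 c = 1 + c * (I.d + 1) ∧ s'.nmem 2 (I.N + c) = 1 + c * (I.d + 1) ∧
          s'.rmem 2 c = I.target c + I.ε ∧ s'.rmem 2 (I.N + c) = I.target c - I.ε) ∧
        s'.rmem 2 (2 * I.N) = 0) I.N
      ⟨by simpa using h10, by simpa using h11, by simpa using h12, by simpa using h13, by simp, ?_⟩
      (fun n s' hn hu ⟨g10, g11, g12, g13, gt, gz⟩ => ⟨?_, ?_⟩) ?_)
    fun s₂ u₂ ⟨g10, g11, g12, g13, gt, gz⟩ => Runs.block (l := [.natStore 2 4 11]) ?_) ?_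
    (fun _ _ h => h)
  · simp [Instr.apply, h.nreg, h.dim, h.num, h.input, MaxconInstance.realWords, two_mul]
  · rw [u₁.rmem, h.rhs]
    simp [Instr.realArrays]
  · have e₁ : s'.nreg 1 = I.N := by
      rw [hu.nreg, h1]
      exact fun h => absurd (subset_natRegs_tableStep h) (by simp)
    simp only [Test.Holds]; omega
  · have e : ∀ k < 10, s'.nreg k = s₁.nreg k := fun k hk => hu.nreg k
      fun h => absurd (subset_natRegs_tableStep h) (by simp; omega)
    have er : s'.rreg 1 = I.ε := by
      rw [hu.rreg, r1]
      exact fun h => absurd (subset_realRegs_tableStep h) (by simp)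
    have hb : s'.rmem 0 (1 + n * (I.d + 1) + s'.nreg 0) = I.target n := by
      rw [e 0 (by norm_num), h0, hu.rmem, u₁.rmem, h.input, I.getD_realWords le_rfl, if_neg]
      · simp
      · simp [Instr.realArrays]
      · simp [collect_realArrays_tableStep]
    refine (runs_tableStep hn ((e 2 (by norm_num)).trans h2) g10 g11 g12 g13 hb).mono le_rfl
      fun s₂ _ ⟨f10, f11, f12, f13, fn, fr⟩ => ⟨f10, ?_, f12, f13, fun c hc => ?_, ?_⟩
    · rw [f11, e 0 (by norm_num), h0]
      ring
    · rw [fn, fn, fr, fr, er]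
      rcases Nat.lt_succ_iff_lt_or_eq.mp hc with hc | rfl
      · obtain ⟨q₁, q₂, q₃, q₄⟩ := gt c hc
        rw [if_neg (by omega), if_neg (by omega), if_neg (by omega), if_neg (by omega),
          if_neg (by omega), if_neg (by omega)]
        exact ⟨q₁, q₂, q₃, q₄⟩
      · rw [if_pos (by omega), if_pos (by omega), if_pos rfl, if_neg (by omega), if_pos rfl]
        exact ⟨rfl, rfl, rfl, rfl⟩
    · rw [fr, if_neg (by omega), if_neg (by omega), gz]
  · rintro s' hu ⟨g10, -⟩
    have e₁ : s'.nreg 1 = I.N := by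
      rw [hu.nreg, h1]
      exact fun h => absurd (subset_natRegs_tableStep h) (by simp)
    simp only [Test.Holds]; omega
  · have hn : ∀ k < 10, s₂.nreg k = s₁.nreg k := fun k hk => u₂.nreg k
      fun h => absurd (subset_natRegs_tableStep h) (by simp; omega)
    have hr : ∀ k < 10, s₂.rreg k = s₁.rreg k := fun k hk => u₂.rreg k
      fun h => absurd (subset_realRegs_tableStep h) (by simp; omega)
    have hm : ∀ k, s₂.rmem 0 k = I.realWords.getD k 0 := fun k => by
      rw [u₂.rmem, u₁.rmem, h.input]
      · simp [Instr.realArrays]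
      · simp [Program.collect, collect_realArrays_tableStep]
    have h3 : s₁.nreg 3 = 0 := by rw [u₁.nreg, h.nreg]; simp [Instr.natRegs]
    have r0 : s₁.rreg 0 = 0 := by rw [u₁.rreg, h.rreg]; simp [Instr.realRegs]
    obtain ⟨s₃, hs₃⟩ : ∃ s₃, s₃ = [Instr.natStore 2 4 11].foldl (fun s e => e.apply s) s₂ :=
      ⟨_, rfl⟩
    have hn₃ : s₃.nreg = s₂.nreg := by rw [hs₃]; rfl
    have hr₃ : s₃.rreg = s₂.rreg := by rw [hs₃]; rfl
    have hm₃ : s₃.rmem = s₂.rmem := by rw [hs₃]; rfl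
    -- The entry `2 * I.N` receives the address of the first word after the input, where zeros are
    -- read; its right hand side was never written and is zero too. This is the trivial equation.
    have haddr : ∀ c ≤ 2 * I.N, s₃.nmem 2 c =
        1 + (if c < I.N then c else c - I.N) * (I.d + 1) := fun c hc => by
      have : s₃.nmem 2 c = if c = 2 * I.N then 1 + I.N * (I.d + 1) else s₂.nmem 2 c := by
        rw [hs₃]
        simp [Instr.apply, Function.update_apply, hn, h4, g11]
      rw [this]
      rcases hc.lt_or_eq with hc | rfl
      · rw [if_neg hc.ne]
        split_ifs with hcN
        · exact (gt c hcN).1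
        · have := (gt (c - I.N) (by omega)).2.1
          rwa [show I.N + (c - I.N) = c by omega] at this
      · rw [if_pos rfl, if_neg (by omega), show 2 * I.N - I.N = I.N by omega]
    rw [← hs₃]
    refine ⟨⟨⟨?_, ?_, ?_, ?_⟩, ?_, ?_, ?_, fun c hc j hj => ?_, fun c hc => ?_, fun i hi => ?_⟩,
      ?_, ?_⟩
    · rw [hn₃, hn 2 (by norm_num), h2]
    · rw [hn₃, hn 3 (by norm_num), h3]
    · rw [hr₃, hr 0 (by norm_num), r0]
    · rw [hr₃, hr 2 (by norm_num), r2]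
    · rw [hn₃, hn 0 (by norm_num), h0]
    · rw [hn₃, hn 1 (by norm_num), h1]
    · rw [hr₃, hr 1 (by norm_num), r1]
    · rw [hm₃, hm, haddr c hc, I.getD_realWords hj.le, if_pos hj, MaxconInstance.row]
    · rw [hm₃, MaxconInstance.rhs]
      split_ifs with h₁ h₂
      · exact (gt c h₁).2.2.1
      · have := (gt (c - I.N) (by omega)).2.2.2
        rwa [show I.N + (c - I.N) = c by omega] at this
      · rw [show c = 2 * I.N by omega, gz]
    · rw [hm₃, hm, haddr i (by omega), if_pos hi, I.getD_realWords le_rfl, if_neg (lt_irrefl _)]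
    · rw [hn₃, hn 4 (by norm_num), h4]
    · rw [hn₃, hn 6 (by norm_num), h6]
  · simp only [List.length_cons, List.length_nil]
    omega

theorem runs_firstProg (hc : Consts s) {d M : ℕ} (h0 : s.nreg 0 = d) (h4 : s.nreg 4 = M) :
    Runs firstProg s (10 * (d + 1)) (fun s' =>
      (∀ k < d, s'.nmem 3 k = M) ∧ s'.nmem 3 d = 1) := by
  refine Runs.mono (Runs.seq (R := fun s' => s'.nreg 10 = 1 ∧ s'.nreg 12 = 0) (Runs.block ?_)
    fun s₁ u₁ ⟨h10, h12⟩ => Runs.seq (Runs.loop_up (T := 4)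
      (Inv := fun n s' => s'.nreg 10 = n + 1 ∧ s'.nreg 12 = n ∧ ∀ k < n, s'.nmem 3 k = M) d
      ⟨by simpa using h10, by simpa using h12, by simp⟩
      (fun n s' hn hu ⟨g10, g12, gm⟩ => ⟨?_, Runs.block ?_⟩) ?_)
    fun s₂ u₂ ⟨g10, g12, gm⟩ => Runs.block ?_) ?_ (fun _ _ h => h)
  · simp [Instr.apply]
  · have e : s'.nreg 0 = d := by rw [hu.nreg, u₁.nreg, h0] <;> simp [Instr.natRegs]
    simp only [Test.Holds]; omega
  · have e₂ : s'.nreg 2 = 1 := by rw [hu.nreg, u₁.nreg, hc.nat_one] <;> simp [Instr.natRegs]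
    have e₄ : s'.nreg 4 = M := by rw [hu.nreg, u₁.nreg, h4] <;> simp [Instr.natRegs]
    refine ⟨by simp [Instr.apply, *], by simp [Instr.apply, *], fun k hk => ?_⟩
    rcases Nat.lt_succ_iff_lt_or_eq.mp hk with hk | rfl
    · simp [Instr.apply, *, hk.ne]
    · simp [Instr.apply, *]
  · rintro s' hu ⟨g10, -⟩
    have e : s'.nreg 0 = d := by rw [hu.nreg, u₁.nreg, h0] <;> simp [Instr.natRegs]
    simp only [Test.Holds]; omega
  · have e₀ : s₂.nreg 0 = d := by
      rw [u₂.nreg, u₁.nreg, h0] <;> simp [Instr.natRegs, Program.collect]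
    have e₂ : s₂.nreg 2 = 1 := by
      rw [u₂.nreg, u₁.nreg, hc.nat_one] <;> simp [Instr.natRegs, Program.collect]
    refine ⟨fun k hk => ?_, by simp [Instr.apply, *]⟩
    simp [Instr.apply, *, hk.ne]
  · simp only [List.length_cons, List.length_nil]
    omega

/-- Finds a vector of maximum consensus. -/
def maxconProg : Program := .seq tableProg (.seq firstProg searchProg)

/-- Decides whether the maximum consensus is at least the integer word number `2` of the input. -/
def maxconDProg : Program :=
  .seq maxconProg (.seq (block [.natConst 10 2, .natLoad 0 10 10])
    (.ite (.natLe 10 5) (block [.natStore 1 3 2]) .skip))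

theorem runs_maxconProg (h : Start I s) :
    Runs maxconProg s (500 * (I.d + 1) ^ 3 * (I.N + 1) * (2 * I.N + I.d).choose I.d) (fun s' =>
      s'.nreg 5 ≤ I.consensus (fun j => s'.rmem 1 j) ∧ s'.nreg 2 = 1 ∧
        ∀ t, IsTuple I.d (2 * I.N) t → (∃ y, I.Solves t y) →
          ∃ x, I.Solves t x ∧ I.consensus (fun j => x j) ≤ s'.nreg 5) := by
  refine Runs.mono (Runs.seq (runs_tableProg h) fun s₁ u₁ ⟨r₁, h4, h6⟩ =>
    Runs.seq (runs_firstProg r₁.toConsts r₁.dim h4) fun s₂ u₂ ⟨h₁, h₂⟩ =>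
    runs_searchProg (I := I) ?_ h₁ h₂ ?_ ?_) ?_ (fun _ _ h => h)
  · refine r₁.of_unchanged u₂ (fun k hk => ?_) (fun k hk => ?_) ?_ ?_ <;>
      simp [firstProg, Program.collect, Instr.natRegs, Instr.realRegs, Instr.natArrays,
        Instr.realArrays] <;> omega
  · rw [u₂.nreg, h6]
    simp [firstProg, Program.collect, Instr.natRegs]
  · rw [u₂.nreg, u₁.nreg, h.nreg]
    · exact Nat.zero_le _
    · simp [tableProg, tableStep, Program.collect, Instr.natRegs]
    · simp [firstProg, Program.collect, Instr.natRegs]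
  · have hC : 1 ≤ (2 * I.N + I.d).choose I.d := Nat.choose_pos (Nat.le_add_left _ _)
    have h₁ : (I.d + 1) * 1 ≤ (I.d + 1) ^ 3 * (I.N + 1) :=
      Nat.mul_le_mul (Nat.le_self_pow (by norm_num) _) (by omega)
    have h₂ : 1 * (I.N + 1) ≤ (I.d + 1) ^ 3 * (I.N + 1) :=
      Nat.mul_le_mul_right _ (Nat.one_le_pow _ _ (Nat.succ_pos _))
    have h₃ : (I.d + 1) ^ 3 * (I.N + 1) * 1 ≤
      (I.d + 1) ^ 3 * (I.N + 1) * (2 * I.N + I.d).choose I.d := Nat.mul_le_mul_left _ hC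
    nlinarith

end RealRAM

namespace MaxconInstance

open RealRAM

/-! ## Vectors of maximum consensus -/

theorem exists_forall_le_of_bounded {α : Type*} {p : α → Prop} (f : α → ℕ) {B : ℕ}
    (hne : ∃ x, p x) (hB : ∀ x, f x ≤ B) : ∃ x, p x ∧ ∀ z, p z → f z ≤ f x := by
  obtain ⟨x, hx⟩ := hne
  have hbdd : BddAbove (f '' {x | p x}) := ⟨B, by rintro _ ⟨z, -, rfl⟩; exact hB z⟩
  obtain ⟨y, hy, hfy⟩ := Nat.sSup_mem (⟨f x, x, hx, rfl⟩ : (f '' {x | p x}).Nonempty) hbdd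
  exact ⟨y, hy, fun z hz => hfy ▸ le_csSup hbdd ⟨z, hz, rfl⟩⟩

/-- Moving a point of a strip in a direction transversal to the strip, one stays in the strip until
one meets its boundary. -/
theorem exists_abs_add_mul_eq {ε r w : ℝ} (hr : |r| ≤ ε) (hw : w ≠ 0) :
    ∃ τ, 0 ≤ τ ∧ |r + τ * w| = ε ∧ ∀ σ, 0 ≤ σ → σ ≤ τ → |r + σ * w| ≤ ε := by
  have hε : 0 ≤ ε := (abs_nonneg r).trans hr
  obtain ⟨h₁, h₂⟩ := abs_le.mp hr
  rcases hw.lt_or_gt with hw | hw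
  · have hτ : (ε + r) / -w * -w = ε + r := div_mul_cancel₀ _ (by linarith)
    refine ⟨(ε + r) / -w, div_nonneg (by linarith) (by linarith), ?_, fun σ h0 hσ => ?_⟩
    · rw [show r + (ε + r) / -w * w = -ε by linarith, abs_neg, abs_of_nonneg hε]
    · have := mul_le_mul_of_nonneg_right hσ (show 0 ≤ -w by linarith)
      have := mul_nonneg h0 (show 0 ≤ -w by linarith)
      exact abs_le.mpr ⟨by linarith, by linarith⟩
  · have hτ : (ε - r) / w * w = ε - r := div_mul_cancel₀ _ hw.ne'
    refine ⟨(ε - r) / w, div_nonneg (by linarith) hw.le, ?_, fun σ h0 hσ => ?_⟩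
    · rw [hτ, add_sub_cancel, abs_of_nonneg hε]
    · have := mul_le_mul_of_nonneg_right hσ hw.le
      have := mul_nonneg h0 hw.le
      exact abs_le.mpr ⟨by linarith, by linarith⟩

/-- A linear functional that vanishes on `V` but not at `u`, represented by its values on the
standard basis. -/
theorem exists_dotProduct_of_notMem {d : ℕ} {V : Submodule ℝ (Fin d → ℝ)} {u : Fin d → ℝ}
    (hu : u ∉ V) : ∃ v : Fin d → ℝ, u ⬝ᵥ v ≠ 0 ∧ ∀ w ∈ V, w ⬝ᵥ v = 0 := by
  obtain ⟨f, hf, hV⟩ := Submodule.exists_le_ker_of_notMem hu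
  have h : ∀ w, w ⬝ᵥ (fun i => f fun j => if i = j then 1 else 0) = f w := fun w => by
    rw [LinearMap.pi_apply_eq_sum_univ f w]
    rfl
  exact ⟨_, by rwa [h], fun w hw => by rw [h]; exact hV hw⟩

/-- A nonempty intersection of strips contains a point such that the normals of the strips with
that point on the boundary span the normals of all the strips. -/
theorem exists_tight (I : MaxconInstance) (S : Set (Fin I.N))
    (hne : ∃ y : Fin I.d → ℝ, ∀ i ∈ S, |I.a i ⬝ᵥ y - I.b i| ≤ I.ε) :
    ∃ x : Fin I.d → ℝ, (∀ i ∈ S, |I.a i ⬝ᵥ x - I.b i| ≤ I.ε) ∧ ∀ i ∈ S,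
      I.a i ∈ Submodule.span ℝ (I.a '' {i | |I.a i ⬝ᵥ x - I.b i| = I.ε}) := by
  -- Maximising the dimension, which is at most `I.d`, replaces an iterated moving argument.
  -- Tightness is considered for all measurements, not only for those in `S`.
  obtain ⟨x, hx, hmax⟩ := exists_forall_le_of_bounded
    (fun x => Module.finrank ℝ
      (Submodule.span ℝ (I.a '' {i | |I.a i ⬝ᵥ x - I.b i| = I.ε})))
    (B := I.d) hne fun x => by
      simpa using Submodule.finrank_le (R := ℝ) (M := Fin I.d → ℝ) _
  refine ⟨x, hx, ?_⟩
  by_contra! hcon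
  obtain ⟨k, hk, hka⟩ := hcon
  obtain ⟨v, hkv, hv⟩ := exists_dotProduct_of_notMem hka
  classical
  have hτ : ∀ i : Fin I.N, ∃ τ : ℝ, i ∈ S → I.a i ⬝ᵥ v ≠ 0 → 0 ≤ τ ∧
      |I.a i ⬝ᵥ x - I.b i + τ * I.a i ⬝ᵥ v| = I.ε ∧
      ∀ σ, 0 ≤ σ → σ ≤ τ → |I.a i ⬝ᵥ x - I.b i + σ * I.a i ⬝ᵥ v| ≤ I.ε := fun i => by
    by_cases hi : i ∈ S ∧ I.a i ⬝ᵥ v ≠ 0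
    · obtain ⟨τ, h⟩ := exists_abs_add_mul_eq (hx i hi.1) hi.2
      exact ⟨τ, fun _ _ => h⟩
    · exact ⟨0, fun h₁ h₂ => absurd ⟨h₁, h₂⟩ hi⟩
  choose τ hτ using hτ
  -- The strip of `S` whose boundary is met first; up to that time no strip of `S` is left. The
  -- candidate `k` shows that some strip is met.
  obtain ⟨m, hm, hmin⟩ := Finset.exists_min_image
    (Finset.univ.filter fun i => i ∈ S ∧ I.a i ⬝ᵥ v ≠ 0) τ ⟨k, by simp [hk, hkv]⟩
  simp only [Finset.mem_filter, Finset.mem_univ, true_and] at hm hmin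
  obtain ⟨hm0, hm1, -⟩ := hτ m hm.1 hm.2
  have hres : ∀ i, I.a i ⬝ᵥ (x + τ m • v) - I.b i =
      I.a i ⬝ᵥ x - I.b i + τ m * I.a i ⬝ᵥ v := fun i => by
    rw [dotProduct_add, dotProduct_smul, smul_eq_mul]
    ring
  have hle := hmax (x + τ m • v) fun i hi => by
    rw [hres]
    by_cases hiv : I.a i ⬝ᵥ v = 0
    · rw [hiv, mul_zero, add_zero]
      exact hx i hi
    · exact (hτ i hi hiv).2.2 _ hm0 (hmin i ⟨hi, hiv⟩)
  -- Old tight normals are orthogonal to `v`, so they remain tight; `I.a m` is newly tight and not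
  -- orthogonal to `v`, so the span grows strictly.
  refine absurd hle (not_le.mpr (Submodule.finrank_lt_finrank_of_lt (lt_of_le_of_ne ?_ ?_)))
  · refine Submodule.span_mono (Set.image_mono fun i hi => ?_)
    rw [Set.mem_ofPred_eq, hres, hv _ (Submodule.subset_span ⟨i, hi, rfl⟩), mul_zero, add_zero]
    exact hi
  · intro heq
    refine hm.2 (hv _ ?_)
    rw [heq]
    exact Submodule.subset_span ⟨m, by rw [Set.mem_ofPred_eq, hres, hm1], rfl⟩

theorem exists_isTuple {d K : ℕ} (m : Multiset ℕ) (hcard : m.card = d) (hK : ∀ c ∈ m, c ≤ K) :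
    ∃ t, IsTuple d K t ∧ (∀ k < d, t k ∈ m) ∧ ∀ c ∈ m, ∃ k < d, t k = c := by
  have hlen : m.sort.length = d := by rw [Multiset.length_sort, hcard]
  have ht : ∀ k (hk : k < d), (if k < d then m.sort.getD k 0 else 1) =
      m.sort[k]'(hlen ▸ hk) := fun k hk => by
    rw [if_pos hk, List.getD_eq_getElem _ _ (hlen ▸ hk)]
  have hmem : ∀ k < d, (if k < d then m.sort.getD k 0 else 1) ∈ m := fun k hk => by
    rw [ht k hk]
    exact (Multiset.mem_sort _).mp (List.getElem_mem _)
  refine ⟨fun k => if k < d then m.sort.getD k 0 else 1, ⟨fun i j hij hj => ?_,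
    fun i hi => hK _ (hmem i hi), by simp⟩, hmem, fun c hc => ?_⟩
  · rw [ht i (by omega), ht j hj]
    rcases hij.lt_or_eq with hij | rfl
    · exact List.pairwise_iff_getElem.mp (Multiset.pairwise_sort m (· ≤ ·)) _ _ _ _ hij
    · exact le_rfl
  · obtain ⟨k, hk, hkc⟩ := List.getElem_of_mem ((Multiset.mem_sort (· ≤ ·)).mpr hc)
    exact ⟨k, hlen ▸ hk, (ht k (hlen ▸ hk)).trans hkc⟩

/-- Some tuple selects a solvable system of equations all of whose solutions have maximum
consensus. -/
theorem exists_tuple_of_maximum (I : MaxconInstance) :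
    ∃ t, IsTuple I.d (2 * I.N) t ∧ (∃ y, I.Solves t y) ∧
      ∀ x, I.Solves t x → ∀ z, I.consensus z ≤ I.consensus (fun j => x j) := by
  obtain ⟨y, -, hy⟩ := exists_forall_le_of_bounded (p := fun _ => True) I.consensus (B := I.N)
    ⟨0, trivial⟩ fun x => by
      refine (Finset.sum_le_card_nsmul _ _ 1 fun i _ => ?_).trans (by simp)
      split_ifs <;> norm_num
  set S : Set (Fin I.N) := {i | |I.a i ⬝ᵥ y - I.b i| ≤ I.ε} with hS
  obtain ⟨x, hxS, hx⟩ := I.exists_tight S ⟨y, fun i hi => hi⟩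
  set T := I.a '' {i | |I.a i ⬝ᵥ x - I.b i| = I.ε} with hT
  -- A basis of the span taken from the tight normals themselves, so that each member belongs to one
  -- of the enumerated hyperplanes.
  obtain ⟨g, hgT, hg, -⟩ := Submodule.exists_fun_fin_finrank_span_eq ℝ T
  have hr : Module.finrank ℝ (Submodule.span ℝ T) ≤ I.d := by
    simpa using Submodule.finrank_le (R := ℝ) (M := Fin I.d → ℝ) (Submodule.span ℝ T)
  have hcode : ∀ l, ∃ c < 2 * I.N, (∀ z : ℕ → ℝ, dot I.d (I.row c) z = g l ⬝ᵥ fun j => z j) ∧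
      I.rhs c = g l ⬝ᵥ x := fun l => by
    obtain ⟨i, hi, hil⟩ := hgT l
    rw [Set.mem_ofPred_eq, abs_eq I.ε_nonneg] at hi
    rcases hi with hi | hi
    · refine ⟨i, by omega, fun z => ?_, ?_⟩
      · rw [row, if_pos i.2, dot_coeff, hil]
      · rw [rhs, if_pos i.2, target, dif_pos i.2, ← hil]
        linarith
    · refine ⟨I.N + i, by omega, fun z => ?_, ?_⟩
      · rw [row, if_neg (by omega), Nat.add_sub_cancel_left, dot_coeff, hil]
      · rw [rhs, if_neg (by omega), if_pos (by omega), Nat.add_sub_cancel_left, target,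
          dif_pos i.2, ← hil]
        linarith
  choose c hc hrow hrhs using hcode
  -- The basis may have fewer than `I.d` members; the code `2 * I.N` of the trivial equation fills
  -- up the multiset.
  obtain ⟨t, ht, htm, hmt⟩ := exists_isTuple (d := I.d) (K := 2 * I.N)
    (Finset.univ.val.map c + Multiset.replicate
      (I.d - Module.finrank ℝ (Submodule.span ℝ T)) (2 * I.N)) (by simp; omega) (by
      intro b hb
      rcases Multiset.mem_add.mp hb with hb | hb
      · obtain ⟨l, -, rfl⟩ := Multiset.mem_map.mp hb
        exact (hc l).le
      · exact (Multiset.eq_of_mem_replicate hb).le)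
  refine ⟨t, ht, ⟨fun j => if h : j < I.d then x ⟨j, h⟩ else 0, fun k hk => ?_⟩,
    fun z hz w => (hy w trivial).trans ?_⟩
  · rcases Multiset.mem_add.mp (htm k hk) with hb | hb
    · obtain ⟨l, -, hl⟩ := Multiset.mem_map.mp hb
      rw [← hl, hrow, hrhs]
      simp
    · rw [Multiset.eq_of_mem_replicate hb, rhs, if_neg (by omega), if_neg (by omega)]
      refine Finset.sum_eq_zero fun j _ => ?_
      rw [row, coeff, dif_neg, zero_mul]
      split_ifs <;> omega
  · have hspan : ∀ u ∈ Submodule.span ℝ T, u ⬝ᵥ (fun j : Fin I.d => z j) = u ⬝ᵥ x := by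
      rw [← hg]
      intro u hu
      induction hu using Submodule.span_induction with
      | mem u hu =>
        obtain ⟨l, rfl⟩ := hu
        obtain ⟨k, hk, hkc⟩ := hmt (c l) (Multiset.mem_add.mpr
          (Or.inl (Multiset.mem_map_of_mem _ (Finset.mem_val.mpr (Finset.mem_univ l)))))
        rw [← hrow, ← hrhs, ← hkc]
        exact hz k hk
      | zero => simp
      | add u v _ _ hu hv => rw [add_dotProduct, add_dotProduct, hu, hv]
      | smul r u _ hu => rw [smul_dotProduct, smul_dotProduct, hu]
    -- Inliers of `y` remain inliers of `z`, whose products with their normals agree with those of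
    -- `x`; the other terms on the left are zero.
    refine Finset.sum_le_sum fun i _ => ?_
    by_cases hi : i ∈ S
    · have := hxS i hi
      rw [← hspan _ (hx i hi)] at this
      rw [if_pos this]
      split_ifs <;> norm_num
    · rw [if_neg (show ¬ |I.a i ⬝ᵥ y - I.b i| ≤ I.ε from hi)]
      exact Nat.zero_le _

/-! ## Running time -/

/-- For `N ≥ 2` a constant factor suffices: passing from `d` to `d + 1` multiplies the binomial
coefficient by `(2 * N + d + 1) / (d + 1)`, which is at most `N` once `d ≥ 3`. The factor quadratic
in `d` is needed only for `N = 1`, where the power is `1`. -/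
theorem choose_two_mul_add_le (N d : ℕ) :
    (2 * N + d).choose d ≤ 10 * (d + 2) ^ 2 * max 1 N ^ d := by
  have hsq : 1 ≤ (d + 2) ^ 2 := Nat.one_le_pow _ _ (by omega)
  rcases N with _ | _ | N
  · simp
    omega
  · rw [show 2 * (0 + 1) + d = d + 2 by ring, Nat.choose_symm_add, Nat.choose_two_right]
    simp only [zero_add, max_self, one_pow, mul_one]
    refine (Nat.div_le_self _ _).trans ?_
    calc (d + 2) * (d + 2 - 1) ≤ (d + 2) * (d + 2) := Nat.mul_le_mul_left _ (Nat.sub_le _ _)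
      _ ≤ 10 * (d + 2) ^ 2 := by nlinarith
  · rw [max_eq_right (by omega)]
    have key : (2 * (N + 2) + d).choose d ≤ 10 * (N + 2) ^ d := by
      have hstep : ∀ d, (2 * (N + 2) + d + 1) * (2 * (N + 2) + d).choose d =
          (2 * (N + 2) + d + 1).choose (d + 1) * (d + 1) := fun d =>
        Nat.add_one_mul_choose_eq _ _
      have h₁ : (2 * (N + 2) + 1).choose 1 = 2 * N + 5 := by rw [Nat.choose_one_right]; ring
      have h₂ : (2 * (N + 2) + 2).choose 2 = (N + 3) * (2 * N + 5) := by
        have := hstep 1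
        rw [h₁] at this
        exact Nat.eq_of_mul_eq_mul_right two_pos (this.symm.trans (by ring))
      have h₃ : (2 * (N + 2) + 3).choose 3 * 3 = (2 * N + 7) * ((N + 3) * (2 * N + 5)) := by
        have := hstep 2
        rw [h₂] at this
        exact this.symm.trans (by ring)
      -- Below `3` the ratio of consecutive coefficients can exceed `N`, so these cases and the base
      -- case `3` are computed directly.
      rcases d with _ | _ | _ | d
      · simp
      · simp
      · rw [h₂]
        change (N + 3) * (2 * N + 5) ≤ 10 * (N + 2) ^ 2
        nlinarith
      · clear hsq
        induction d with
        | zero =>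
          refine Nat.le_of_mul_le_mul_right (h₃.le.trans ?_) three_pos
          change (2 * N + 7) * ((N + 3) * (2 * N + 5)) ≤ 10 * (N + 2) ^ 3 * 3
          nlinarith [Nat.zero_le (N ^ 3), Nat.zero_le (N ^ 2)]
        | succ d ih =>
          refine Nat.le_of_mul_le_mul_right ((hstep (d + 3)).symm.le.trans ?_)
            (show 0 < d + 3 + 1 by omega)
          calc (2 * (N + 2) + (d + 3) + 1) * (2 * (N + 2) + (d + 3)).choose (d + 3)
              ≤ ((N + 2) * (d + 3 + 1)) * (10 * (N + 2) ^ (d + 3)) :=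
                Nat.mul_le_mul (by nlinarith [Nat.zero_le (N * d)]) ih
            _ = _ := by ring
    calc _ ≤ 10 * (N + 2) ^ d := key
      _ ≤ _ := Nat.mul_le_mul_right _ (by omega)

end MaxconInstance

/-! ### Assembly of the time bounds and membership in XP. -/

namespace RealRAM

/-- The running time of the two programs. -/
theorem time_le (d N : ℕ) :
    500 * (d + 1) ^ 3 * (N + 1) * (2 * N + d).choose d + 8 ≤
      20000 * (d + 2) ^ 5 * max 1 N ^ (d + 2) := by
  have hC := MaxconInstance.choose_two_mul_add_le N d
  set m := max 1 N with hm
  have hm1 : 1 ≤ m := le_max_left _ _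
  have hN : N + 1 ≤ 2 * m := by omega
  calc 500 * (d + 1) ^ 3 * (N + 1) * (2 * N + d).choose d + 8
      ≤ 500 * (d + 2) ^ 3 * (2 * m) * (10 * (d + 2) ^ 2 * m ^ d) + 8 := by gcongr; omega
    _ = 10000 * ((d + 2) ^ 5 * m ^ (d + 1)) + 8 := by ring
    _ ≤ 20000 * ((d + 2) ^ 5 * m ^ (d + 1)) := by
      have : 1 ≤ (d + 2) ^ 5 * m ^ (d + 1) :=
        Nat.one_le_iff_ne_zero.mpr (Nat.mul_ne_zero (by positivity) (by positivity))
      omega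
    -- One factor `m` is given away here.
    _ ≤ 20000 * ((d + 2) ^ 5 * m ^ (d + 2)) := by gcongr <;> omega
    _ = _ := by ring

theorem ParamProblem.SolvableInTime.mono {Q : ParamProblem} {T T' : Q.Inst → ℕ}
    (h : Q.SolvableInTime T) (hT : ∀ I, T I ≤ T' I) : Q.SolvableInTime T' := by
  obtain ⟨p, hp⟩ := h
  refine ⟨p, fun I => ?_⟩
  obtain ⟨s, n, he, hn, hc⟩ := hp I
  exact ⟨s, n, he, hn.trans (hT I), hc⟩

theorem solvable_MAXCON : MAXCON.SolvableInTime
    (fun I : MaxconInstance => 20000 * (I.d + 2) ^ 5 * max 1 I.N ^ (I.d + 2)) := by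
  refine ⟨maxconProg, fun (I : MaxconInstance) => ?_⟩
  have h : Start I (initial [I.d, I.N] I.realWords) := by
    constructor <;> simp [initial]
  obtain ⟨s, n, he, hn, hb, -, ht⟩ := runs_maxconProg h
  refine ⟨s, n, he, (hn.trans (Nat.le_add_right _ 8)).trans (time_le I.d I.N), fun y => ?_⟩
  obtain ⟨t, htt, hex, hmax⟩ := I.exists_tuple_of_maximum
  obtain ⟨x, hx, hxc⟩ := ht t htt hex
  exact ((hmax x hx y).trans hxc).trans hb

theorem solvable_MAXCOND : MAXCOND.SolvableInTime
    (fun I : MaxconDInstance => 20000 * (I.d + 2) ^ 5 * max 1 I.N ^ (I.d + 2)) := by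
  refine ⟨maxconDProg, fun (I : MaxconDInstance) => ?_⟩
  set s₀ := initial [I.d, I.N, I.ψ] I.realWords with hs₀
  have h : Start I.toMaxconInstance s₀ := by
    constructor <;> simp [hs₀, initial]
  obtain ⟨t, htt, hex, hmax⟩ := I.exists_tuple_of_maximum
  have hrun : Runs maxconDProg s₀
      (500 * (I.d + 1) ^ 3 * (I.N + 1) * (2 * I.N + I.d).choose I.d + 8)
      (fun s => ((∃ x : Fin I.d → ℝ, I.ψ ≤ I.consensus x) ∧ s.nmem 1 0 = 1) ∨
        ((¬ ∃ x : Fin I.d → ℝ, I.ψ ≤ I.consensus x) ∧ s.nmem 1 0 = 0)) := by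
    refine Runs.mono (Runs.seq (runs_maxconProg h) fun s₁ u₁ ⟨hb, h2, ht⟩ =>
      Runs.seq (R := fun s => s.nreg 10 = I.ψ) (Runs.block ?_) fun s₂ u₂ h10 =>
      Runs.ite (T := 2) (fun hle => Runs.block ?_) fun hlt => Runs.mono (Runs.skip ?_)
        (by norm_num) fun _ _ h => h) ?_ (fun _ _ h => h)
    · have : s₁.nmem 0 2 = I.ψ := by
        rw [u₁.nmem]
        · simp [hs₀, initial]
        · decide
      simpa [Instr.apply] using this
    · simp only [Test.Holds, h10] at hle
      refine Or.inl ⟨⟨_, hle.trans ((u₂.nreg 5 (by simp [Instr.natRegs])).le.trans hb)⟩, ?_⟩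
      have h3 : s₂.nreg 3 = 0 := by
        rw [u₂.nreg, u₁.nreg]
        · simp [hs₀, initial]
        · decide
        · simp [Instr.natRegs]
      have h2' : s₂.nreg 2 = 1 := by
        rw [u₂.nreg, h2]
        simp [Instr.natRegs]
      simp [Instr.apply, *]
    · simp only [Test.Holds, h10] at hlt
      refine Or.inr ⟨fun ⟨z, hz⟩ => hlt ?_, ?_⟩
      -- The recorded value is at least the maximum consensus, so a failed comparison with `ψ`
      -- refutes the existence of `z`.
      · obtain ⟨x, hx, hxc⟩ := ht t htt hex
        rw [u₂.nreg 5 (by simp [Instr.natRegs])]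
        exact (hz.trans (hmax x hx z)).trans hxc
      · rw [u₂.nmem, u₁.nmem]
        · simp [hs₀, initial]
        · decide
        · simp [Instr.natArrays]
    · simp only [List.length_cons, List.length_nil]
      omega
  obtain ⟨s, n, he, hn, hc⟩ := hrun
  exact ⟨s, n, he, hn.trans (time_le I.d I.N), hc⟩

theorem computable_bound : Computable (fun k : ℕ => 20000 * (k + 2) ^ 5) := by
  have h : Primrec (fun k : ℕ => k + 2) := Primrec.succ.comp Primrec.succ
  have h' := Primrec.nat_mul.comp (Primrec.const 20000) (Primrec.nat_mul.comp
    (Primrec.nat_mul.comp (Primrec.nat_mul.comp h h) (Primrec.nat_mul.comp h h)) h)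
  exact (h'.of_eq fun k => by ring).to_comp

theorem ParamProblem.SolvableInTime.inXP {Q : ParamProblem} {m : Q.Inst → ℕ}
    (h : Q.SolvableInTime (fun I => 20000 * (Q.param I + 2) ^ 5 * m I ^ (Q.param I + 2)))
    (hm : ∀ I, m I ≤ Q.size I) : Q.InXP :=
  ⟨fun k => 20000 * (k + 2) ^ 5, fun k => k + 2, computable_bound,
    (Primrec.succ.comp Primrec.succ).to_comp, h.mono fun I =>
      Nat.mul_le_mul_left _ (Nat.pow_le_pow_left (hm I) _)⟩

end RealRAM

theorem max_one_le_length (I : MaxconInstance) : max 1 I.N ≤ I.realWords.length := by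
  rw [I.length_realWords]
  refine max_le (by omega) ?_
  nlinarith [Nat.zero_le (I.N * I.d)]

theorem mainTheorem2 :
    MAXCON.InXP ∧ MAXCOND.InXP ∧
    (∃ P : Polynomial ℕ, MAXCON.SolvableInTime
      (fun I : MaxconInstance => P.eval I.d * max 1 I.N ^ (I.d + 2))) ∧
    (∃ P : Polynomial ℕ, MAXCOND.SolvableInTime
      (fun I : MaxconDInstance => P.eval I.d * max 1 I.N ^ (I.d + 2))) := by
  refine ⟨RealRAM.solvable_MAXCON.inXP fun I => (max_one_le_length I).trans (Nat.le_add_left _ _),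
    RealRAM.solvable_MAXCOND.inXP fun I =>
      (max_one_le_length I.toMaxconInstance).trans (Nat.le_add_left _ _),
    ⟨20000 * (Polynomial.X + 2) ^ 5, ?_⟩, ⟨20000 * (Polynomial.X + 2) ^ 5, ?_⟩⟩
  · simpa using RealRAM.solvable_MAXCON
  · simpa using RealRAM.solvable_MAXCOND
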